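/- There is an absolute constant $C$ such that every finite simple undirected graph $G$ on $n$ vertices with minimum degree at least $C\log n$ is antimagic; that is, if $m$ denotes the number of edges of $G$, there is a bijection $f\colon E(G)\to\{1,\dots,m\}$ such that the vertex sums $\sum_{e\ni v} f(e)$ (over all edges $e$ incident with $v$), $v\in V(G)$, are pairwise distinct. -/

import Mathlib

namespace SimpleGraph

/-- The vertex sum of `v` under the edge labeling `f`: the sum of the labels of all edges
incident with `v`. Only the values of `f` on edges of `G` matter. -/
def vertexSum {V : Type*} [Fintype V] [DecidableEq V] (G : SimpleGraph V) [DecidableRel G.Adj]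
    (f : Sym2 V → ℕ) (v : V) : ℕ :=
  ∑ e ∈ G.incidenceFinset v, f e

/-- An antimagic labeling: a bijection from the edge set to `{1, …, m}`, where `m` is the number
of edges, such that the vertex sums are pairwise distinct. -/
def IsAntimagicLabeling {V : Type*} [Fintype V] [DecidableEq V] (G : SimpleGraph V)
    [DecidableRel G.Adj] (f : Sym2 V → ℕ) : Prop :=
  Set.BijOn f G.edgeSet (Set.Icc 1 G.edgeFinset.card) ∧ Function.Injective (G.vertexSum f)

/-- A graph is antimagic if it has an antimagic labeling. -/
def IsAntimagic {V : Type*} [Fintype V] [DecidableEq V] (G : SimpleGraph V)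
    [DecidableRel G.Adj] : Prop :=
  ∃ f : Sym2 V → ℕ, G.IsAntimagicLabeling f

end SimpleGraph

/-
By Hall's theorem every vertex has three private incident edges. A minimal edge cover inside the
first private edges is a union of stars; its edges are grouped into gadgets, single edges or pairs
of edges with a common centre, and like gadgets into `N` rows of four edges with signs
`+, +, -, -`. A row receives the labels `k(t+1), k(N+t+1), k(3N-t), k(4N-t)` of some column `t`.
Increasing `t` moves these labels by `k` according to the signs, and within each gadget the
movements cancel or add up in such a way that every vertex, up to boundedly many, is affected by
exactly one row. If row `i` takes the column `π i`, the sum at `v` is therefore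
`W v + k * σ v * π (ρ v)`, where `ρ v` is the row of `v` and `W` collects the contribution of the
remaining labels.

Two vertices can only collide if their values of `W` agree modulo `k`. Since the other two private
edges of each vertex lie outside the rows, a random arrangement of the remaining labels leaves few
such coincidences. Each of them rules out few pairs of cells of the permutation `π`, and the
lopsided local lemma for random permutations yields a `π` avoiding all of them.
-/

open Finset

section LocalLemma

variable {Ω J : Type*} [Fintype Ω]

/-- The outcomes at which none of the events `A j` with `j ∈ S` occurs. -/
def avoiding (A : J → Ω → Prop) [∀ j, DecidablePred (A j)] (S : Finset J) : Finset Ω :=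
  {ω | ∀ j ∈ S, ¬A j ω}

variable {A : J → Ω → Prop} [∀ j, DecidablePred (A j)]

theorem mem_avoiding {S : Finset J} {ω : Ω} : ω ∈ avoiding A S ↔ ∀ j ∈ S, ¬A j ω := by
  simp [avoiding]

theorem avoiding_subset_avoiding {S T : Finset J} (h : S ⊆ T) : avoiding A T ⊆ avoiding A S :=
  fun _ hω => mem_avoiding.2 fun j hj => mem_avoiding.1 hω j (h hj)

theorem avoiding_insert [DecidableEq J] (a : J) (S : Finset J) :
    avoiding A (insert a S) = {ω ∈ avoiding A S | ¬A a ω} := by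
  ext ω
  simp only [mem_avoiding, mem_filter, forall_mem_insert]
  exact and_comm

theorem card_avoiding_le_add_sum [DecidableEq J] (S T : Finset J) :
    #(avoiding A S) ≤ #(avoiding A (S ∪ T)) + ∑ j ∈ T, #{ω ∈ avoiding A S | A j ω} := by
  classical
  have hcover : avoiding A S ⊆
      avoiding A (S ∪ T) ∪ T.biUnion fun j => {ω ∈ avoiding A S | A j ω} := by
    intro ω hω
    by_cases hT : ∃ j ∈ T, A j ω
    · obtain ⟨j, hj, hA⟩ := hT
      exact mem_union_right _ (mem_biUnion.2 ⟨j, hj, mem_filter.2 ⟨hω, hA⟩⟩)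
    · push Not at hT
      refine mem_union_left _ (mem_avoiding.2 fun j hj => ?_)
      exact (mem_union.1 hj).elim (mem_avoiding.1 hω j) (hT j)
  calc #(avoiding A S) ≤ _ := card_le_card hcover
    _ ≤ _ := card_union_le _ _
    _ ≤ _ := Nat.add_le_add_left card_biUnion_le _

variable {near : J → J → Prop} [DecidableRel near] {E : Finset J} {M d : ℕ}

/- Avoiding the events far from `a` costs at most a factor two compared with avoiding all of `S`,
by the induction hypothesis for the at most `d` events of `S` near `a`. -/
theorem mul_card_avoiding_filter_le (hM : 0 < M) (hdM : 4 * d ≤ M)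
    (hd : ∀ a ∈ E, #{j ∈ E | near a j} ≤ d)
    (hlop : ∀ a ∈ E, ∀ S ⊆ E, (∀ j ∈ S, ¬near a j) →
      M * #{ω ∈ avoiding A S | A a ω} ≤ #(avoiding A S))
    {S : Finset J} (hS : S ⊆ E) {a : J} (ha : a ∈ E) :
    M * #{ω ∈ avoiding A S | A a ω} ≤ 2 * #(avoiding A S) := by
  classical
  induction S using Finset.strongInduction generalizing a with
  | H S ih =>
  set close := {j ∈ S | near a j}
  set far := {j ∈ S | ¬near a j}
  have hfar : far ⊆ S := filter_subset _ _
  have hunion : far ∪ close = S := by rw [union_comm]; exact filter_union_filter_not_eq _ S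
  have hlose : #(avoiding A far) ≤ 2 * #(avoiding A S) := by
    rcases close.eq_empty_or_nonempty with hempty | ⟨j, hj⟩
    · rw [hempty, union_empty] at hunion
      rw [hunion]
      exact Nat.le_mul_of_pos_left _ two_pos
    have hssub : far ⊂ S := by
      refine hfar.ssubset_of_not_subset fun h => ?_
      exact (mem_filter.1 (h (mem_filter.1 hj).1)).2 (mem_filter.1 hj).2
    have hclose : #close ≤ d := (card_le_card (filter_subset_filter _ hS)).trans (hd a ha)
    have hsum : M * ∑ j ∈ close, #{ω ∈ avoiding A far | A j ω} ≤
        d * (2 * #(avoiding A far)) := by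
      rw [mul_sum]
      refine (sum_le_card_nsmul _ _ _ fun j hj => ?_).trans (Nat.mul_le_mul_right _ hclose)
      exact ih far hssub (hfar.trans hS) (hS (mem_filter.1 hj).1)
    have hsplit := card_avoiding_le_add_sum (A := A) far close
    rw [hunion] at hsplit
    refine Nat.le_of_mul_le_mul_left ?_ hM
    nlinarith
  calc M * #{ω ∈ avoiding A S | A a ω}
      ≤ M * #{ω ∈ avoiding A far | A a ω} := by
        gcongr
        exact avoiding_subset_avoiding hfar
    _ ≤ #(avoiding A far) := hlop a ha far (hfar.trans hS) fun j hj => (mem_filter.1 hj).2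
    _ ≤ 2 * #(avoiding A S) := hlose

/-- The symmetric lopsided Lovász local lemma, in counting form. -/
theorem exists_forall_not_of_lopsided [Nonempty Ω] (hM : 2 < M) (hdM : 4 * d ≤ M)
    (hd : ∀ a ∈ E, #{j ∈ E | near a j} ≤ d)
    (hlop : ∀ a ∈ E, ∀ S ⊆ E, (∀ j ∈ S, ¬near a j) →
      M * #{ω ∈ avoiding A S | A a ω} ≤ #(avoiding A S)) :
    ∃ ω, ∀ j ∈ E, ¬A j ω := by
  classical
  suffices h : ∀ S ⊆ E, (avoiding A S).Nonempty by
    obtain ⟨ω, hω⟩ := h E Subset.rfl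
    exact ⟨ω, mem_avoiding.1 hω⟩
  intro S
  induction S using Finset.induction_on with
  | empty => exact fun _ => ⟨Classical.arbitrary Ω, by simp [mem_avoiding]⟩
  | insert a S _ ih =>
    intro hS
    obtain ⟨haE, hSE⟩ := insert_subset_iff.1 hS
    have hpos : 0 < #(avoiding A S) := (ih hSE).card_pos
    have hle := mul_card_avoiding_filter_le (by lia) hdM hd hlop hSE haE
    have hadd := card_filter_add_card_filter_not (s := avoiding A S) (A a)
    rw [avoiding_insert, ← card_pos]
    by_contra! hzero
    nlinarith

end LocalLemma

/-- Two cells of the square `ι × ι` lying in different rows, as the pattern of a forbidden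
coincidence of values of a permutation. -/
structure CellPair (ι : Type*) where
  row₁ : ι
  row₂ : ι
  col₁ : ι
  col₂ : ι
  row_ne : row₁ ≠ row₂

namespace CellPair

variable {ι J : Type*}

/-- The graph of `π` contains both cells. -/
abbrev Hits (c : CellPair ι) (π : Equiv.Perm ι) : Prop :=
  π c.row₁ = c.col₁ ∧ π c.row₂ = c.col₂

/-- One of the cells lies in row `i`. -/
abbrev InRow (c : CellPair ι) (i : ι) : Prop :=
  c.row₁ = i ∨ c.row₂ = i

/-- One of the cells lies in column `t`. -/
abbrev InCol (c : CellPair ι) (t : ι) : Prop :=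
  c.col₁ = t ∨ c.col₂ = t

/-- The dependency relation of the local lemma: the cell pairs share a row or a column. -/
abbrev Near (c c' : CellPair ι) : Prop :=
  (c'.InRow c.row₁ ∨ c'.InRow c.row₂) ∨ (c'.InCol c.col₁ ∨ c'.InCol c.col₂)

variable [DecidableEq ι]

theorem card_mul_card_filter_apply_eq_le {C : Finset (Equiv.Perm ι)} {i t : ι} {T : Finset ι}
    (hC : ∀ s ∈ T, ∀ π ∈ C, π i = t → Equiv.swap t s * π ∈ C) :
    #T * #{π ∈ C | π i = t} ≤ #C := by
  calc #T * #{π ∈ C | π i = t} = ∑ _s ∈ T, #{π ∈ C | π i = t} := by simp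
    _ ≤ ∑ s ∈ T, #{π ∈ C | π i = s} := by
      refine sum_le_sum fun s hs => card_le_card_of_injOn (Equiv.swap t s * ·) (fun π hπ => ?_)
        (mul_right_injective _).injOn
      obtain ⟨hπC, hπi⟩ := mem_filter.1 hπ
      exact mem_filter.2 ⟨hC s hs π hπC hπi, by simp [hπi]⟩
    _ = #{π ∈ C | π i ∈ T} := sum_card_fiberwise_eq_card_filter _ _ _
    _ ≤ #C := card_filter_le _ _

variable {b : J → CellPair ι} {S E : Finset J} {K : ℕ}

theorem card_near_le (hrow : ∀ i, #{j ∈ E | (b j).InRow i} ≤ K)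
    (hcol : ∀ t, #{j ∈ E | (b j).InCol t} ≤ K) (c : CellPair ι) :
    #{j ∈ E | c.Near (b j)} ≤ 4 * K := by
  classical
  have hrows : #{j ∈ E | (b j).InRow c.row₁ ∨ (b j).InRow c.row₂} ≤ K + K := by
    rw [filter_or]
    exact (card_union_le _ _).trans (add_le_add (hrow _) (hrow _))
  have hcols : #{j ∈ E | (b j).InCol c.col₁ ∨ (b j).InCol c.col₂} ≤ K + K := by
    rw [filter_or]
    exact (card_union_le _ _).trans (add_le_add (hcol _) (hcol _))
  rw [filter_or]
  exact (card_union_le _ _).trans (by lia)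

variable [Fintype ι]

/- Exchanging the value `t` taken at `i` creates no cell outside row `i` and column `t`. -/
theorem swap_mul_mem_avoiding {i t : ι} (hS : ∀ j ∈ S, ¬(b j).InRow i ∧ ¬(b j).InCol t) (s : ι)
    {π : Equiv.Perm ι} (hπ : π ∈ avoiding (fun j => (b j).Hits) S) (hi : π i = t) :
    Equiv.swap t s * π ∈ avoiding (fun j => (b j).Hits) S := by
  have hcell : ∀ r c, r ≠ i → c ≠ t → (Equiv.swap t s * π) r = c → π r = c := by
    rintro r _ hr hc rfl
    have hrt : π r ≠ t := fun h => hr (π.injective (h.trans hi.symm))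
    have hrs : π r ≠ s := fun h => hc (by simp [h])
    simp [Equiv.swap_apply_of_ne_of_ne hrt hrs]
  rw [mem_avoiding] at hπ ⊢
  intro j hj hhit
  obtain ⟨hrow, hcol⟩ := hS j hj
  push Not at hrow hcol
  exact hπ j hj ⟨hcell _ _ hrow.1 hcol.1 hhit.1, hcell _ _ hrow.2 hcol.2 hhit.2⟩

theorem mul_card_avoiding_filter_hits_le (c : CellPair ι) (hS : ∀ j ∈ S, ¬c.Near (b j)) :
    Fintype.card ι * (Fintype.card ι - 1) * #{π ∈ avoiding (fun j => (b j).Hits) S | c.Hits π} ≤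
      #(avoiding (fun j => (b j).Hits) S) := by
  set C := avoiding (fun j => (b j).Hits) S
  have hS₁ : ∀ j ∈ S, ¬(b j).InRow c.row₁ ∧ ¬(b j).InCol c.col₁ := fun j hj => by
    have := hS j hj; tauto
  have hS₂ : ∀ j ∈ S, ¬(b j).InRow c.row₂ ∧ ¬(b j).InCol c.col₂ := fun j hj => by
    have := hS j hj; tauto
  rcases eq_or_ne c.col₁ c.col₂ with hcol | hcol
  · have hnone : #{π ∈ C | c.Hits π} = 0 := by
      rw [card_eq_zero, filter_eq_empty_iff]
      exact fun π _ h => c.row_ne (π.injective (h.1.trans (hcol.trans h.2.symm)))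
    simp [hnone]
  have hfirst : Fintype.card ι * #{π ∈ C | π c.row₁ = c.col₁} ≤ #C :=
    card_mul_card_filter_apply_eq_le fun s _ _ hπ hi => swap_mul_mem_avoiding hS₁ s hπ hi
  have hsecond : (Fintype.card ι - 1) * #{π ∈ C | c.Hits π} ≤ #{π ∈ C | π c.row₁ = c.col₁} := by
    rw [← card_univ, ← card_erase_of_mem (mem_univ c.col₁), ← filter_filter]
    refine card_mul_card_filter_apply_eq_le fun s hs π hπ hi => ?_
    obtain ⟨hπC, hπ₁⟩ := mem_filter.1 hπ
    refine mem_filter.2 ⟨swap_mul_mem_avoiding hS₂ s hπC hi, ?_⟩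
    rw [Equiv.Perm.mul_apply, hπ₁, Equiv.swap_apply_of_ne_of_ne hcol (mem_erase.1 hs).1.symm]
  rw [mul_assoc]
  exact (Nat.mul_le_mul_left _ hsecond).trans hfirst

theorem exists_perm_forall_not_hits (hι : 2 < Fintype.card ι)
    (hrow : ∀ i, #{j ∈ E | (b j).InRow i} ≤ K) (hcol : ∀ t, #{j ∈ E | (b j).InCol t} ≤ K)
    (hK : 16 * K ≤ Fintype.card ι * (Fintype.card ι - 1)) :
    ∃ π : Equiv.Perm ι, ∀ j ∈ E, ¬(b j).Hits π := by
  classical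
  have hM : 2 < Fintype.card ι * (Fintype.card ι - 1) :=
    hι.trans_le (Nat.le_mul_of_pos_right _ (by lia))
  exact exists_forall_not_of_lopsided (near := fun a j => (b a).Near (b j)) (d := 4 * K) hM
    (by lia) (fun a _ => card_near_le hrow hcol (b a))
    fun a _ S _ hS => mul_card_avoiding_filter_hits_le (b a) hS

end CellPair

section RandomArrangement

variable {α R : Type*} [Fintype α] [DecidableEq α] [CommRing R]

theorem sum_mul_comp_swap (coef g : α → R) (τ : Equiv.Perm α) {a b : α} (hb : coef b = 0) :
    ∑ e, coef e * g ((τ * Equiv.swap a b) e) =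
      ∑ e, coef e * g (τ e) + coef a * (g (τ b) - g (τ a)) := by
  have hterm : ∀ e, coef e * g ((τ * Equiv.swap a b) e) =
      coef e * g (τ e) + if e = a then coef a * (g (τ b) - g (τ a)) else 0 := by
    intro e
    rcases eq_or_ne e a with rfl | hea
    · simp [mul_sub]
    rcases eq_or_ne e b with rfl | heb
    · simp [hb, hea]
    · simp [Equiv.swap_apply_of_ne_of_ne hea heb, hea]
  simp only [hterm, sum_add_distrib, sum_ite_eq', mem_univ, if_true]

theorem card_perm_filter_sum_mul_le [DecidableEq R] (coef g : α → R) (T : R → Prop)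
    [DecidablePred T] (a : α) {M : ℕ} (hM : ∀ c, #{b | T (c + coef a * g b)} ≤ M) :
    #{τ : Equiv.Perm α | T (∑ e, coef e * g (τ e))} * #{b | coef b = 0} ≤
      Fintype.card (Equiv.Perm α) * M := by
  set form : Equiv.Perm α → R := fun τ => ∑ e, coef e * g (τ e)
  set base : Equiv.Perm α → R := fun τ => form τ - coef a * g (τ a)
  have hswap : ∀ b, coef b = 0 → ∀ τ, form (τ * Equiv.swap a b) = base τ + coef a * g (τ b) :=
    fun b hb τ => (sum_mul_comp_swap coef g τ hb).trans (by simp only [form, base]; ring)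
  calc #{τ | T (form τ)} * #{b | coef b = 0}
      = ∑ b with coef b = 0, #{τ | T (form τ)} := by simp [mul_comm]
    _ = ∑ b with coef b = 0, #{τ | T (base τ + coef a * g (τ b))} := by
        refine sum_congr rfl fun b hb => ?_
        simp only [← hswap b (mem_filter.1 hb).2]
        exact (card_equiv (Equiv.mulRight (Equiv.swap a b)) (by simp)).symm
    _ = ∑ τ, #{b ∈ {b | coef b = 0} | T (base τ + coef a * g (τ b))} :=
        (sum_card_bipartiteAbove_eq_sum_card_bipartiteBelow
          (fun b τ => T (base τ + coef a * g (τ b))))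
    _ ≤ ∑ _τ : Equiv.Perm α, M := by
        refine sum_le_sum fun τ _ => (card_le_card_of_injOn τ (fun b hb => ?_)
          τ.injective.injOn).trans (hM (base τ))
        simpa using (mem_filter.1 hb).2
    _ = _ := by simp

end RandomArrangement

theorem mul_card_filter_modEq_le {α : Type*} [Fintype α] {g : α → ℤ} (hg : Function.Injective g)
    {m k : ℕ} (hk : 0 < k) (hgm : ∀ b, g b ∈ Set.Icc 1 (m : ℤ)) (c : ℤ) :
    k * #{b | g b ≡ c [ZMOD k]} ≤ m + k := by
  classical
  have hle : #{b | g b ≡ c [ZMOD k]} ≤ #{x ∈ Ioc (0 : ℤ) m | x ≡ c [ZMOD k]} := by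
    refine card_le_card_of_injOn g (fun b hb => ?_) hg.injOn
    obtain ⟨h₁, h₂⟩ := hgm b
    simpa [Int.lt_iff_add_one_le, h₁, h₂] using hb
  have hcount : (#{x ∈ Ioc (0 : ℤ) m | x ≡ c [ZMOD k]} : ℚ) ≤ m / k + 1 := by
    have h := congrArg (Int.cast : ℤ → ℚ)
      (Int.Ioc_filter_modEq_card 0 (m : ℤ) (r := k) (by lia) c)
    push_cast at h
    rw [h]
    refine max_le ?_ (by positivity)
    have h₁ := Int.floor_le (((m : ℚ) - c) / k)
    have h₂ := Int.lt_floor_add_one ((0 - (c : ℚ)) / k)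
    have hdiff : ((m : ℚ) - c) / k - (0 - c) / k = m / k := by ring
    linarith
  have hmul : (k : ℚ) * #{b | g b ≡ c [ZMOD k]} ≤ m + k := by
    calc (k : ℚ) * #{b | g b ≡ c [ZMOD k]} ≤ k * (m / k + 1) := by
          gcongr
          exact (Nat.cast_le.2 hle).trans hcount
      _ = m + k := by field_simp
  exact_mod_cast hmul

section Gadgets

variable {V : Type*} [DecidableEq V]

/-- Incidence of a vertex with an edge, as an integer. -/
def incidence (v : V) (e : Sym2 V) : ℤ :=
  if v ∈ e then 1 else 0

/-- One edge, or two edges with a common endpoint, whose labels are to be moved simultaneously: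
by opposite amounts or by the same amount. -/
inductive Gadget (V : Type*)
  | single (e : Sym2 V)
  | opposite (e e' : Sym2 V)
  | parallel (e e' : Sym2 V)

namespace Gadget

/-- The edges of a gadget. -/
def edges : Gadget V → Multiset (Sym2 V)
  | single e => {e}
  | opposite e e' => {e, e'}
  | parallel e e' => {e, e'}

/-- The rate at which the sum at `v` changes when the labels of the gadget are moved. -/
def effect (v : V) : Gadget V → ℤ
  | single e => incidence v e
  | opposite e e' => incidence v e - incidence v e'
  | parallel e e' => incidence v e + incidence v e'

theorem effect_single_ne_zero {v : V} {e : Sym2 V} : (single e).effect v ≠ 0 ↔ v ∈ e := by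
  simp [effect, incidence]

theorem effect_opposite_ne_zero {v : V} {e e' : Sym2 V} :
    (opposite e e').effect v ≠ 0 ↔ ¬(v ∈ e ↔ v ∈ e') := by
  by_cases h : v ∈ e <;> by_cases h' : v ∈ e' <;> simp [effect, incidence, h, h']

theorem effect_parallel_ne_zero {v : V} {e e' : Sym2 V} :
    (parallel e e').effect v ≠ 0 ↔ v ∈ e ∨ v ∈ e' := by
  by_cases h : v ∈ e <;> by_cases h' : v ∈ e' <;> simp [effect, incidence, h, h']

theorem exists_mem_edges_of_effect_ne_zero {v : V} {a : Gadget V} (h : a.effect v ≠ 0) :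
    ∃ e ∈ a.edges, v ∈ e := by
  cases a <;>
    simp only [effect_single_ne_zero, effect_opposite_ne_zero, effect_parallel_ne_zero] at h <;>
    simp [edges] <;> tauto

/-- Edge-disjoint gadgets with edges in `F`, such that each vertex covered by `F` is affected by
exactly one of them. -/
structure IsCover (F : Finset (Sym2 V)) (us : Multiset (Gadget V)) : Prop where
  edges_le : us.bind edges ≤ F.val
  countP_le_one : ∀ v, us.countP (effect v · ≠ 0) ≤ 1
  exists_mem : ∀ e ∈ F, ∀ v ∈ e, ∃ a ∈ us, a.effect v ≠ 0

theorem isCover_empty : IsCover (∅ : Finset (Sym2 V)) 0 where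
  edges_le := by simp
  countP_le_one := by simp
  exists_mem := by simp

variable {F X : Finset (Sym2 V)} {us : Multiset (Gadget V)}

theorem IsCover.cons (h : IsCover (F \ X) us) {a : Gadget V} (hX : a.edges = X.val) (hXF : X ⊆ F)
    (hdisj : ∀ v, a.effect v ≠ 0 → ∀ e ∈ F \ X, v ∉ e)
    (hcov : ∀ e ∈ X, ∀ v ∈ e, a.effect v ≠ 0 ∨ ∃ e' ∈ F \ X, v ∈ e') : IsCover F (a ::ₘ us) where
  edges_le := by
    rw [Multiset.cons_bind, hX]
    refine (add_le_add_right h.edges_le X.val).trans_eq ?_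
    rw [sdiff_val, add_tsub_cancel_of_le (val_le_iff.2 hXF)]
  countP_le_one v := by
    rw [Multiset.countP_cons]
    split_ifs with hav
    · suffices hzero : us.countP (effect v · ≠ 0) = 0 by rw [hzero]
      refine Multiset.countP_eq_zero.2 fun b hb hbv => ?_
      obtain ⟨e, he, hve⟩ := exists_mem_edges_of_effect_ne_zero hbv
      have heF := Multiset.mem_of_le h.edges_le (Multiset.mem_bind.2 ⟨b, hb, he⟩)
      exact hdisj v hav e heF hve
    · exact h.countP_le_one v
  exists_mem e he v hv := by
    have hrest : (∃ e' ∈ F \ X, v ∈ e') → ∃ b ∈ a ::ₘ us, b.effect v ≠ 0 := by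
      rintro ⟨e', he', hv'⟩
      obtain ⟨b, hb, hbv⟩ := h.exists_mem e' he' v hv'
      exact ⟨b, Multiset.mem_cons_of_mem hb, hbv⟩
    by_cases heX : e ∈ X
    · exact (hcov e heX v hv).elim (fun hav => ⟨a, Multiset.mem_cons_self a us, hav⟩) hrest
    · exact hrest ⟨e, mem_sdiff.2 ⟨he, heX⟩, hv⟩

/- Peel off an edge `s(x, z)` with private endpoint `x`. If another edge at `z` exists, its private
endpoint is not `z`, and the two edges form a gadget: parallel if they are the only edges at `z`,
and otherwise opposite, which leaves the sum at `z` unchanged. -/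
theorem exists_isCover (F : Finset (Sym2 V))
    (hF : ∀ e ∈ F, ∃ v ∈ e, ∀ e' ∈ F, v ∈ e' → e' = e) : ∃ us, IsCover F us := by
  induction F using Finset.strongInduction with
  | H F ih =>
  rcases F.eq_empty_or_nonempty with rfl | ⟨e, he⟩
  · exact ⟨0, isCover_empty⟩
  have hrec : ∀ X ⊆ F, X.Nonempty → ∃ us, IsCover (F \ X) us := fun X hXF hX =>
    ih _ (sdiff_ssubset hXF hX) fun f hf => by
      obtain ⟨v, hv, hpriv⟩ := hF f (mem_sdiff.1 hf).1
      exact ⟨v, hv, fun f' hf' => hpriv f' (mem_sdiff.1 hf').1⟩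
  obtain ⟨x, hxe, hx⟩ := hF e he
  obtain ⟨z, rfl⟩ := Sym2.mem_iff_exists.1 hxe
  by_cases hother : ∃ e' ∈ F, e' ≠ s(x, z) ∧ z ∈ e'
  · obtain ⟨e', he', hne, hze'⟩ := hother
    obtain ⟨y, hye', hy⟩ := hF e' he'
    have hyz : y ≠ z := by rintro rfl; exact hne (hy _ he (Sym2.mem_mk_right x y)).symm
    obtain rfl : e' = s(y, z) := (Sym2.mem_and_mem_iff hyz).1 ⟨hye', hze'⟩
    have hX : ({s(x, z), s(y, z)} : Finset (Sym2 V)) ⊆ F := by simp [insert_subset_iff, he, he']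
    obtain ⟨us, hus⟩ := hrec _ hX (insert_nonempty _ _)
    have hval : ({s(x, z), s(y, z)} : Finset (Sym2 V)).val = {s(x, z), s(y, z)} := by
      simp [hne.symm]
    by_cases hthird : ∃ e'' ∈ F, e'' ≠ s(x, z) ∧ e'' ≠ s(y, z) ∧ z ∈ e''
    · refine ⟨_, hus.cons (a := opposite s(x, z) s(y, z)) hval.symm hX ?_ ?_⟩ <;>
        simp only [effect_opposite_ne_zero, mem_sdiff, mem_insert, mem_singleton] <;> grind
    · refine ⟨_, hus.cons (a := parallel s(x, z) s(y, z)) hval.symm hX ?_ ?_⟩ <;>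
        simp only [effect_parallel_ne_zero, mem_sdiff, mem_insert, mem_singleton] <;> grind
  · obtain ⟨us, hus⟩ := hrec {s(x, z)} (singleton_subset_iff.2 he) (singleton_nonempty _)
    refine ⟨_, hus.cons (a := single s(x, z)) rfl (singleton_subset_iff.2 he) ?_ ?_⟩ <;>
      simp only [effect_single_ne_zero, mem_sdiff, mem_singleton] <;> grind

end Gadget

end Gadgets

section Rows

theorem exists_multiset_le_card_eq {α : Type*} {s : Multiset α} {n : ℕ} (h : n ≤ s.card) :
    ∃ t ≤ s, t.card = n := by
  induction s using Quotient.inductionOn with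
  | h l => exact ⟨l.take n, (List.take_sublist n l).subperm, by simpa using h⟩

variable {V : Type*}

/-- Four edges forming gadgets of one kind. Whatever the kind, the labels of the four edges are
moved in the directions `rowSign`. -/
inductive Row (V : Type*)
  | singles (e₀ e₁ e₂ e₃ : Sym2 V)
  | opposites (e₀ e₁ e₂ e₃ : Sym2 V)
  | parallels (e₀ e₁ e₂ e₃ : Sym2 V)

/-- The directions in which the four labels of a row are moved. -/
def rowSign : Fin 4 → ℤ := ![1, 1, -1, -1]

namespace Row

/-- The edges of a row. -/
def edge : Row V → Fin 4 → Sym2 V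
  | singles e₀ e₁ e₂ e₃ => ![e₀, e₁, e₂, e₃]
  | opposites e₀ e₁ e₂ e₃ => ![e₀, e₁, e₂, e₃]
  | parallels e₀ e₁ e₂ e₃ => ![e₀, e₁, e₂, e₃]

/-- The gadgets that a row consists of. -/
def gadgets : Row V → Multiset (Gadget V)
  | singles e₀ e₁ e₂ e₃ => {.single e₀, .single e₁, .single e₂, .single e₃}
  | opposites e₀ e₁ e₂ e₃ => {.opposite e₀ e₂, .opposite e₁ e₃}
  | parallels e₀ e₁ e₂ e₃ => {.parallel e₀ e₁, .parallel e₂ e₃}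

theorem map_edge_eq_bind (r : Row V) :
    (univ : Finset (Fin 4)).val.map r.edge = r.gadgets.bind Gadget.edges := by
  cases r <;> simp [edge, gadgets, Gadget.edges, List.ofFn_succ, ← Multiset.cons_coe,
    Multiset.cons_swap]

theorem exists_gadgets_le {us : Multiset (Gadget V)} (h : 6 ≤ us.card) :
    ∃ r : Row V, r.gadgets ≤ us := by
  obtain ⟨S, Q, R, rfl⟩ : ∃ (S : Multiset (Sym2 V)) (Q R : Multiset (Sym2 V × Sym2 V)),
      us = S.map .single + Q.map (fun p => .opposite p.1 p.2) +
        R.map (fun p => .parallel p.1 p.2) := by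
    clear h
    induction us using Multiset.induction with
    | empty => exact ⟨0, 0, 0, rfl⟩
    | cons a us ih =>
      obtain ⟨S, Q, R, rfl⟩ := ih
      cases a with
      | single e => exact ⟨e ::ₘ S, Q, R, by simp⟩
      | opposite e e' => exact ⟨S, (e, e') ::ₘ Q, R, by simp⟩
      | parallel e e' => exact ⟨S, Q, (e, e') ::ₘ R, by simp⟩
  simp only [Multiset.card_add, Multiset.card_map] at h
  obtain hS | hQ | hR : 4 ≤ S.card ∨ 2 ≤ Q.card ∨ 2 ≤ R.card := by lia
  · obtain ⟨T, hT, hcard⟩ := exists_multiset_le_card_eq hS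
    obtain ⟨e₀, e₁, e₂, e₃, rfl⟩ := Multiset.card_eq_four.1 hcard
    refine ⟨.singles e₀ e₁ e₂ e₃, ?_⟩
    rw [add_assoc]
    exact le_add_of_le_of_nonneg (Multiset.map_le_map hT) zero_le
  · obtain ⟨T, hT, hcard⟩ := exists_multiset_le_card_eq hQ
    obtain ⟨⟨e₀, e₂⟩, ⟨e₁, e₃⟩, rfl⟩ := Multiset.card_eq_two.1 hcard
    refine ⟨.opposites e₀ e₁ e₂ e₃, ?_⟩
    rw [add_right_comm]
    exact le_add_of_nonneg_of_le zero_le (Multiset.map_le_map hT)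
  · obtain ⟨T, hT, hcard⟩ := exists_multiset_le_card_eq hR
    obtain ⟨⟨e₀, e₁⟩, ⟨e₂, e₃⟩, rfl⟩ := Multiset.card_eq_two.1 hcard
    exact ⟨.parallels e₀ e₁ e₂ e₃, le_add_of_nonneg_of_le zero_le (Multiset.map_le_map hT)⟩

theorem exists_eq_sum_gadgets_add (us : Multiset (Gadget V)) :
    ∃ (N : ℕ) (row : Fin N → Row V) (rest : Multiset (Gadget V)),
      us = ∑ i, (row i).gadgets + rest ∧ rest.card ≤ 5 := by
  induction us using Multiset.strongInductionOn with
  | ih us ih =>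
  by_cases h : us.card ≤ 5
  · exact ⟨0, Fin.elim0, us, by simp, h⟩
  obtain ⟨r, hr⟩ := exists_gadgets_le (not_le.1 h)
  obtain ⟨us', rfl⟩ := Multiset.le_iff_exists_add.1 hr
  have hpos : 0 < r.gadgets.card := by cases r <;> simp [gadgets]
  have hlt : us' < r.gadgets + us' := lt_add_of_pos_left us' (Multiset.card_pos.1 hpos).bot_lt
  obtain ⟨N, row, rest, hus', hrest⟩ := ih us' hlt
  exact ⟨N + 1, Fin.cons r row, rest, by simp [Fin.sum_univ_succ, hus', add_assoc], hrest⟩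

variable {ι : Type*} [Fintype ι] {row : ι → Row V}

theorem edge_injective {F : Finset (Sym2 V)}
    (h : (∑ i, (row i).gadgets).bind Gadget.edges ≤ F.val) :
    Function.Injective fun p : ι × Fin 4 => (row p.1).edge p.2 := by
  have hmap : (univ : Finset (ι × Fin 4)).val.map (fun p => (row p.1).edge p.2) =
      (∑ i, (row i).gadgets).bind Gadget.edges := by
    change (univ.val.bind fun i => univ.val.map (Prod.mk i)).map _ =
      (univ.val.bind fun i => (row i).gadgets).bind Gadget.edges
    simp only [Multiset.map_bind, Multiset.bind_assoc, Multiset.map_map, ← map_edge_eq_bind]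
    rfl
  have hnodup : ((univ : Finset (ι × Fin 4)).val.map fun p => (row p.1).edge p.2).Nodup := by
    rw [hmap]
    exact Multiset.nodup_of_le h F.nodup
  exact fun p p' => Multiset.inj_on_of_nodup_map hnodup p (mem_univ p) p' (mem_univ p')

variable [DecidableEq V]

/-- The rate at which the sum at `v` changes when the labels of the row are moved. -/
def effect (r : Row V) (v : V) : ℤ :=
  ∑ j, rowSign j * incidence v (r.edge j)

theorem effect_ne_zero_iff {r : Row V} {v : V}
    (hr : r.gadgets.countP (Gadget.effect v · ≠ 0) ≤ 1) :
    r.effect v ≠ 0 ↔ ∃ a ∈ r.gadgets, a.effect v ≠ 0 := by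
  have hsum (e₀ e₁ e₂ e₃ : Sym2 V) : ∑ j, rowSign j * incidence v (![e₀, e₁, e₂, e₃] j) =
      incidence v e₀ + incidence v e₁ - incidence v e₂ - incidence v e₃ := by
    simp [Fin.sum_univ_four, rowSign]; ring
  cases r <;>
    simp only [gadgets, Multiset.insert_eq_cons, ← Multiset.cons_zero, Multiset.countP_cons,
      Multiset.countP_zero, effect, edge, hsum, Multiset.mem_cons, Multiset.notMem_zero, or_false,
      exists_eq_or_imp, exists_eq_left] at hr ⊢ <;>
    simp only [Gadget.effect] at hr ⊢ <;> lia

theorem countP_gadgets_le {v : V}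
    (h : (∑ i, (row i).gadgets).countP (Gadget.effect v · ≠ 0) ≤ 1) (i : ι) :
    (row i).gadgets.countP (Gadget.effect v · ≠ 0) ≤ 1 :=
  (Multiset.countP_le_of_le _ (single_le_sum_of_canonicallyOrdered (mem_univ i))).trans h

theorem eq_of_effect_ne_zero {v : V}
    (h : (∑ i, (row i).gadgets).countP (Gadget.effect v · ≠ 0) ≤ 1) {i i' : ι}
    (hi : (row i).effect v ≠ 0) (hi' : (row i').effect v ≠ 0) : i = i' := by
  classical
  have hpos : ∀ i, (row i).effect v ≠ 0 → 0 < (row i).gadgets.countP (Gadget.effect v · ≠ 0) :=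
    fun i hi => Multiset.countP_pos.2 ((effect_ne_zero_iff (countP_gadgets_le h i)).1 hi)
  by_contra hne
  have hsum := sum_le_univ_sum_of_nonneg (s := {i, i'})
    fun i => Nat.zero_le ((row i).gadgets.countP (Gadget.effect v · ≠ 0))
  rw [sum_pair hne] at hsum
  replace hi := hpos i hi
  replace hi' := hpos i' hi'
  simp only [← Multiset.coe_countPAddMonoidHom, map_sum] at h hsum hi hi'
  lia

end Row

end Rows

section RowSystem

variable {V : Type*}

theorem card_le_two_mul_of_forall_exists_mem {s : Finset V} {t : Finset (Sym2 V)}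
    (h : ∀ v ∈ s, ∃ e ∈ t, v ∈ e) : #s ≤ 2 * #t := by
  classical
  have hsub : s ⊆ t.biUnion Sym2.toFinset := fun v hv => by
    simpa only [mem_biUnion, Sym2.mem_toFinset] using h v hv
  rw [mul_comm]
  refine (card_le_card hsub).trans (card_biUnion_le_card_mul _ _ 2 fun e _ => ?_)
  rw [Sym2.card_toFinset]
  split_ifs <;> lia

theorem exists_subset_covering_of_covering {F₀ : Finset (Sym2 V)} (hF₀ : ∀ v, ∃ e ∈ F₀, v ∈ e) :
    ∃ F ⊆ F₀, (∀ v, ∃ e ∈ F, v ∈ e) ∧ ∀ e ∈ F, ∃ v ∈ e, ∀ e' ∈ F, v ∈ e' → e' = e := by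
  classical
  obtain ⟨F, hFF₀, hF⟩ :=
    exists_minimal_le_of_wellFoundedLT (fun F : Finset (Sym2 V) => ∀ v, ∃ e ∈ F, v ∈ e) F₀ hF₀
  refine ⟨F, hFF₀, hF.prop, fun e he => ?_⟩
  have herase : ¬∀ v, ∃ e' ∈ F.erase e, v ∈ e' := hF.not_prop_of_lt (erase_ssubset he)
  push Not at herase
  obtain ⟨v, hv⟩ := herase
  have hpriv : ∀ e' ∈ F, v ∈ e' → e' = e := fun e' he' hve' => by
    by_contra hne
    exact hv e' (mem_erase.2 ⟨hne, he'⟩) hve'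
  obtain ⟨e', he', hve'⟩ := hF.prop v
  exact ⟨v, hpriv e' he' hve' ▸ hve', hpriv⟩

theorem Gadget.card_bind_edges_le (us : Multiset (Gadget V)) :
    (us.bind edges).card ≤ 2 * us.card := by
  rw [Multiset.card_bind]
  refine (Multiset.sum_le_card_nsmul _ 2 fun k hk => ?_).trans_eq (by simp [mul_comm])
  obtain ⟨a, -, rfl⟩ := Multiset.mem_map.1 hk
  cases a <;> simp [edges]

variable [DecidableEq V] [Fintype V] {N : ℕ}

theorem Row.card_effect_ne_zero_le (r : Row V) : #{v | r.effect v ≠ 0} ≤ 8 := by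
  have hmem : ∀ v ∈ ({v | r.effect v ≠ 0} : Finset V), ∃ e ∈ univ.image r.edge, v ∈ e := by
    intro v hv
    obtain ⟨j, -, hj⟩ := exists_ne_zero_of_sum_ne_zero (mem_filter.1 hv).2
    exact ⟨_, mem_image_of_mem _ (mem_univ j), by_contra fun h => hj (by simp [incidence, h])⟩
  have hfour : #(univ.image r.edge) ≤ 4 := card_image_le.trans_eq (card_fin 4)
  exact (card_le_two_mul_of_forall_exists_mem hmem).trans (by lia)

theorem exists_rows {F : Finset (Sym2 V)} (hcov : ∀ v, ∃ e ∈ F, v ∈ e)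
    (hpriv : ∀ e ∈ F, ∃ v ∈ e, ∀ e' ∈ F, v ∈ e' → e' = e) :
    ∃ (N : ℕ) (row : Fin N → Row V),
      (Function.Injective fun p : Fin N × Fin 4 => (row p.1).edge p.2) ∧
      (∀ i j, (row i).edge j ∈ F) ∧
      (∀ v i i', (row i).effect v ≠ 0 → (row i').effect v ≠ 0 → i = i') ∧
      #{v | ∀ i, (row i).effect v = 0} ≤ 20 := by
  obtain ⟨us, hus⟩ := Gadget.exists_isCover F hpriv
  obtain ⟨N, row, rest, rfl, hrest⟩ := Row.exists_eq_sum_gadgets_add us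
  have hedges : (∑ i, (row i).gadgets).bind Gadget.edges ≤ F.val := by
    refine le_trans ?_ hus.edges_le
    rw [Multiset.add_bind]
    exact le_add_right le_rfl
  have hcount : ∀ v, (∑ i, (row i).gadgets).countP (Gadget.effect v · ≠ 0) ≤ 1 := fun v =>
    (Multiset.countP_le_of_le _ (le_add_right le_rfl)).trans (hus.countP_le_one v)
  refine ⟨N, row, Row.edge_injective hedges, fun i j => ?_,
    fun v i i' => Row.eq_of_effect_ne_zero (hcount v), ?_⟩
  · refine Multiset.mem_of_le hedges (Multiset.mem_bind.2 ?_)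
    have hj : (row i).edge j ∈ (row i).gadgets.bind Gadget.edges := by
      rw [← Row.map_edge_eq_bind]
      exact Multiset.mem_map_of_mem _ (mem_univ j)
    obtain ⟨a, ha, haj⟩ := Multiset.mem_bind.1 hj
    exact ⟨a, Multiset.mem_of_le (single_le_sum_of_canonicallyOrdered (mem_univ i)) ha, haj⟩
  have hstatic : ∀ v ∈ ({v | ∀ i, (row i).effect v = 0} : Finset V),
      ∃ e ∈ (rest.bind Gadget.edges).toFinset, v ∈ e := by
    intro v hv
    obtain ⟨e, he, hve⟩ := hcov v
    obtain ⟨a, ha, hav⟩ := hus.exists_mem e he v hve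
    obtain ha | ha := Multiset.mem_add.1 ha
    · obtain ⟨i, -, hai⟩ := Multiset.mem_sum.1 ha
      exact absurd ((mem_filter.1 hv).2 i)
        ((Row.effect_ne_zero_iff (Row.countP_gadgets_le (hcount v) i)).2 ⟨a, hai, hav⟩)
    · obtain ⟨e', he', hve'⟩ := Gadget.exists_mem_edges_of_effect_ne_zero hav
      exact ⟨e', Multiset.mem_toFinset.2 (Multiset.mem_bind.2 ⟨a, ha, he'⟩), hve'⟩
  have := card_le_two_mul_of_forall_exists_mem hstatic
  have := Multiset.toFinset_card_le (rest.bind Gadget.edges)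
  have := Gadget.card_bind_edges_le rest
  lia

theorem exists_rowOf {row : Fin N → Row V}
    (huniq : ∀ v i i', (row i).effect v ≠ 0 → (row i').effect v ≠ 0 → i = i')
    (hstatic : #{v | ∀ i, (row i).effect v = 0} ≤ 20) (hV : 20 < Fintype.card V) :
    ∃ rowOf : V → Fin N, (∀ v i, i ≠ rowOf v → (row i).effect v = 0) ∧
      (∀ u v, (row (rowOf u)).effect u = 0 → (row (rowOf v)).effect v = 0 → rowOf u = rowOf v) ∧
      ∀ i, #{v | rowOf v = i} ≤ 28 := by
  classical
  obtain ⟨i₀⟩ : Nonempty (Fin N) := by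
    by_contra hN
    rw [not_nonempty_iff] at hN
    simp [hV.not_ge] at hstatic
  set rowOf : V → Fin N := fun v => if h : ∃ i, (row i).effect v ≠ 0 then h.choose else i₀
  have hspec : ∀ v i, (row i).effect v ≠ 0 → i = rowOf v := fun v i hi => by
    have h : ∃ i, (row i).effect v ≠ 0 := ⟨i, hi⟩
    simp only [rowOf, dif_pos h]
    exact huniq v _ _ hi h.choose_spec
  have hdefault : ∀ v, (row (rowOf v)).effect v = 0 → ∀ i, (row i).effect v = 0 :=
    fun v hv i => by_contra fun hi => hi (hspec v i hi ▸ hv)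
  refine ⟨rowOf, fun v i hi => by_contra fun h => hi (hspec v i h), fun u v hu hv => ?_,
    fun i => ?_⟩
  · have hi₀ : ∀ w, (row (rowOf w)).effect w = 0 → rowOf w = i₀ := fun w hw =>
      dif_neg fun ⟨i, hi⟩ => hi (hdefault w hw i)
    rw [hi₀ u hu, hi₀ v hv]
  · have hsub : ({v | rowOf v = i} : Finset V) ⊆
        ({v | ∀ i, (row i).effect v = 0} : Finset V) ∪ ({v | (row i).effect v ≠ 0} : Finset V) := by
      rintro v hv
      obtain rfl := (mem_filter.1 hv).2
      by_cases h : (row (rowOf v)).effect v = 0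
      · exact mem_union_left _ (mem_filter.2 ⟨mem_univ v, hdefault v h⟩)
      · exact mem_union_right _ (mem_filter.2 ⟨mem_univ v, h⟩)
    have := (row i).card_effect_ne_zero_le
    have := (card_le_card hsub).trans (card_union_le _ _)
    lia

theorem exists_injective_incident (G : SimpleGraph V) [DecidableRel G.Adj]
    (hG : ∀ v, 6 ≤ G.degree v) :
    ∃ e : V × Fin 3 → Sym2 V, Function.Injective e ∧ ∀ p, e p ∈ G.incidenceFinset p.1 := by
  refine (all_card_le_biUnion_card_iff_exists_injective
    fun p : V × Fin 3 => G.incidenceFinset p.1).1 fun s => ?_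
  have hfibres : #s ≤ #(s.image Prod.fst) * 3 := by
    have hsub : s ⊆ s.image Prod.fst ×ˢ (univ : Finset (Fin 3)) := fun p hp => by
      simpa using ⟨p.2, hp⟩
    simpa using card_le_card hsub
  have hdouble : #(s.image Prod.fst) * 6 ≤ #(s.biUnion fun p => G.incidenceFinset p.1) * 2 := by
    refine card_mul_le_card_mul (· ∈ ·) (fun v hv => ?_) fun e _ => ?_
    · obtain ⟨p, hp, rfl⟩ := mem_image.1 hv
      refine (hG p.1).trans ?_
      rw [← G.card_incidenceFinset_eq_degree]
      refine card_le_card fun e he => (mem_bipartiteAbove _).2 ⟨mem_biUnion.2 ⟨p, hp, he⟩, ?_⟩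
      exact ((G.mem_incidenceFinset _ _).1 he).2
    · have hsub : (s.image Prod.fst).bipartiteBelow (· ∈ ·) e ⊆ e.toFinset := fun v hv =>
        Sym2.mem_toFinset.2 ((mem_bipartiteBelow _).1 hv).2
      refine (card_le_card hsub).trans ?_
      rw [Sym2.card_toFinset]
      split_ifs <;> lia
  lia

/-- Disjoint rows of edges of `G`, and an assignment of the vertices to the rows such that each
vertex is affected at most by its own row. Unaffected vertices are all assigned to one row.
An edge outside the rows is free; the free edges separate the vertices. -/
structure RowSystem (G : SimpleGraph V) (N : ℕ) where
  row : Fin N → Row V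
  rowOf : V → Fin N
  edge_injective : Function.Injective fun p : Fin N × Fin 4 => (row p.1).edge p.2
  edge_mem : ∀ i j, (row i).edge j ∈ G.edgeSet
  effect_eq_zero : ∀ v i, i ≠ rowOf v → (row i).effect v = 0
  rowOf_eq : ∀ u v, (row (rowOf u)).effect u = 0 → (row (rowOf v)).effect v = 0 →
    rowOf u = rowOf v
  card_rowOf_eq_le : ∀ i, #{v | rowOf v = i} ≤ 28
  exists_free : ∀ u v, u ≠ v → ∃ e ∈ G.edgeSet, (∀ i j, (row i).edge j ≠ e) ∧ u ∈ e ∧ v ∉ e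

/- Hall's theorem gives every vertex three private incident edges. The rows use only the first
ones, and one of the other two avoids any prescribed second vertex. -/
theorem exists_rowSystem {G : SimpleGraph V} [DecidableRel G.Adj] (hG : 6 ≤ G.minDegree)
    (hV : 20 < Fintype.card V) :
    ∃ N, Nonempty (RowSystem G N) ∧ 4 * N ≤ Fintype.card V ∧ Fintype.card V ≤ 28 * N := by
  obtain ⟨e, he, hinc⟩ := exists_injective_incident G fun v => hG.trans (G.minDegree_le_degree v)
  have hmem : ∀ p, e p ∈ G.edgeSet ∧ p.1 ∈ e p := fun p => (G.mem_incidenceFinset _ _).1 (hinc p)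
  obtain ⟨F, hF, hcov, hpriv⟩ := exists_subset_covering_of_covering
    (F₀ := univ.image fun v => e (v, 0)) fun v =>
      ⟨_, mem_image_of_mem _ (mem_univ v), (hmem (v, 0)).2⟩
  obtain ⟨N, row, hinj, hrowF, huniq, hstatic⟩ := exists_rows hcov hpriv
  obtain ⟨rowOf, hzero, hsame, hfibre⟩ := exists_rowOf huniq hstatic hV
  have hrow : ∀ i j, ∃ v, e (v, 0) = (row i).edge j := fun i j => by
    simpa using hF (hrowF i j)
  have hfree : ∀ u v, u ≠ v →
      ∃ f ∈ G.edgeSet, (∀ i j, (row i).edge j ≠ f) ∧ u ∈ f ∧ v ∉ f := by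
    intro u v huv
    obtain ⟨l, hl, hv⟩ : ∃ l : Fin 3, l ≠ 0 ∧ v ∉ e (u, l) := by
      by_contra! h
      have hone := (Sym2.mem_and_mem_iff huv).1 ⟨(hmem (u, 1)).2, h 1 (by decide)⟩
      have htwo := (Sym2.mem_and_mem_iff huv).1 ⟨(hmem (u, 2)).2, h 2 (by decide)⟩
      simpa using he (hone.trans htwo.symm)
    refine ⟨e (u, l), (hmem _).1, fun i j hij => ?_, (hmem (u, l)).2, hv⟩
    obtain ⟨w, hw⟩ := hrow i j
    exact hl (congrArg Prod.snd (he (hw.trans hij))).symm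
  refine ⟨N, ⟨⟨row, rowOf, hinj, fun i j => ?_, hzero, hsame, hfibre, hfree⟩⟩, ?_, ?_⟩
  · obtain ⟨v, hv⟩ := hrow i j
    exact hv ▸ (hmem _).1
  · calc 4 * N = Fintype.card (Fin N × Fin 4) := by simp [mul_comm]
      _ ≤ #F := card_le_card_of_injOn _ (fun p _ => hrowF p.1 p.2) hinj.injOn
      _ ≤ Fintype.card V := (card_le_card hF).trans card_image_le
  · have := card_le_mul_card_image_of_maps_to (s := univ) (fun v _ => mem_univ (rowOf v)) 28
      fun i _ => hfibre i
    simpa using this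

end RowSystem

section Separation

variable {V : Type*}

/-- Integer sums at the vertices, each depending on a parameter in `Fin N`. The parameter is common
to the vertices of a row, and moving it by one changes a sum by a multiple of `modulus`. -/
structure MovingSums (V : Type*) (N : ℕ) where
  /-- The sums when all the parameters are zero. -/
  base : V → ℤ
  row : V → Fin N
  /-- The common divisor of the changes. -/
  modulus : ℤ
  /-- The change of a sum, in units of `modulus`, when its parameter is moved by one. -/
  speed : V → ℤ
  modulus_ne_zero : modulus ≠ 0
  base_ne {u v : V} : u ≠ v → row u = row v → base u ≠ base v
  row_eq_of_speed_eq_zero {u v : V} : speed u = 0 → speed v = 0 → row u = row v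

namespace MovingSums

variable {N : ℕ} (S : MovingSums V N)

/-- The sum at `v` when its parameter is `t`. -/
def value (v : V) (t : Fin N) : ℤ :=
  S.base v + S.modulus * S.speed v * t

/-- The cells that a permutation has to contain for a collision to happen. When the vertices share
a row, the idle parameter is placed in another row, given by the derangement `ν`. -/
def cells {ν : Equiv.Perm (Fin N)} (hν : ∀ i, ν i ≠ i) (j : (V × V) × (Fin N × Fin N)) :
    CellPair (Fin N) where
  row₁ := S.row j.1.1
  row₂ := if S.row j.1.1 = S.row j.1.2 then ν (S.row j.1.1) else S.row j.1.2
  col₁ := j.2.1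
  col₂ := j.2.2
  row_ne := by split_ifs with h; exacts [(hν _).symm, h]

variable {S}

theorem value_injective {v : V} (hv : S.speed v ≠ 0) : Function.Injective (S.value v) := by
  intro s t hst
  simpa [value, S.modulus_ne_zero, hv, Fin.val_inj] using hst

theorem card_speed_eq_zero_le [Fintype V] {q : ℕ} (hq : ∀ i, #{v | S.row v = i} ≤ q) :
    #{v | S.speed v = 0} ≤ q := by
  obtain h | ⟨v, hv⟩ := ({v | S.speed v = 0} : Finset V).eq_empty_or_nonempty
  · simp [h]
  · refine (card_le_card fun u hu => ?_).trans (hq (S.row v))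
    simp only [mem_filter, mem_univ, true_and] at hu hv ⊢
    exact S.row_eq_of_speed_eq_zero hu hv

end MovingSums

variable [Fintype V]

/-- The ordered pairs of distinct vertices at which `W` takes congruent values modulo `k`. -/
def congruentPairs (k : ℤ) (W : V → ℤ) : Finset (V × V) :=
  {p ∈ univ.offDiag | W p.1 ≡ W p.2 [ZMOD k]}

variable {k : ℤ} {W : V → ℤ}

theorem mem_congruentPairs {p : V × V} :
    p ∈ congruentPairs k W ↔ p.1 ≠ p.2 ∧ W p.1 ≡ W p.2 [ZMOD k] := by
  simp [congruentPairs]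

theorem swap_mem_congruentPairs {p : V × V} (hp : p ∈ congruentPairs k W) :
    p.swap ∈ congruentPairs k W := by
  rw [mem_congruentPairs] at hp ⊢
  exact ⟨hp.1.symm, hp.2.symm⟩

variable [DecidableEq V]

theorem card_congruentPairs_filter_fst_mem_le {c : ℕ}
    (hc : ∀ u, #{p ∈ congruentPairs k W | p.1 = u} ≤ c) (S : Finset V) :
    #{p ∈ congruentPairs k W | p.1 ∈ S} ≤ #S * c := by
  rw [mul_comm]
  refine card_le_mul_card_image_of_maps_to (fun p hp => (mem_filter.1 hp).2) c fun u _ => ?_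
  exact (card_le_card (filter_subset_filter _ (filter_subset _ _))).trans (hc u)

theorem card_congruentPairs_filter_snd_mem_le {c : ℕ}
    (hc : ∀ u, #{p ∈ congruentPairs k W | p.1 = u} ≤ c) (S : Finset V) :
    #{p ∈ congruentPairs k W | p.2 ∈ S} ≤ #S * c := by
  refine le_trans ?_ (card_congruentPairs_filter_fst_mem_le hc S)
  refine card_le_card_of_injOn Prod.swap (fun p hp => ?_) Prod.swap_injective.injOn
  obtain ⟨hp, hpS⟩ := mem_filter.1 hp
  exact mem_filter.2 ⟨swap_mem_congruentPairs hp, hpS⟩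

namespace MovingSums

variable {N : ℕ} (S : MovingSums V N)

/-- The pairs of vertices with sums congruent modulo `modulus`, whatever the parameters. -/
abbrev pairs : Finset (V × V) :=
  congruentPairs S.modulus S.base

/-- The coincidences of sums to be avoided: two distinct vertices with a parameter for each. When
the vertices share a row the first parameter counts for both and the second one is idle. -/
def collisions : Finset ((V × V) × (Fin N × Fin N)) :=
  {j | j.1.1 ≠ j.1.2 ∧
    S.value j.1.1 j.2.1 = S.value j.1.2 (if S.row j.1.1 = S.row j.1.2 then j.2.1 else j.2.2)}

variable {S}

theorem mem_collisions {u v : V} {s t : Fin N} :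
    ((u, v), s, t) ∈ S.collisions ↔
      u ≠ v ∧ S.value u s = S.value v (if S.row u = S.row v then s else t) := by
  simp [collisions]

theorem fst_mem_pairs_of_mem_collisions {j : (V × V) × (Fin N × Fin N)} (hj : j ∈ S.collisions) :
    j.1 ∈ S.pairs := by
  obtain ⟨hne, hval⟩ := (mem_filter.1 hj).2
  refine mem_congruentPairs.2 ⟨hne, ?_⟩
  rw [value, value, mul_assoc, mul_assoc] at hval
  simpa [Int.ModEq] using congrArg (· % S.modulus) hval

theorem fst_param_unique {u v : V} {s s' t : Fin N} (huv : S.row u = S.row v ∨ S.speed u ≠ 0)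
    (h : ((u, v), s, t) ∈ S.collisions) (h' : ((u, v), s', t) ∈ S.collisions) : s = s' := by
  rw [mem_collisions] at h h'
  by_cases hrow : S.row u = S.row v
  · simp only [if_pos hrow, value] at h h'
    have hspeed : S.speed u ≠ S.speed v := fun heq =>
      S.base_ne h.1 hrow (by simpa [heq] using h.2)
    have hmul : S.modulus * (S.speed u - S.speed v) * (s : ℤ) =
        S.modulus * (S.speed u - S.speed v) * s' := by linear_combination h.2 - h'.2
    simpa [S.modulus_ne_zero, sub_ne_zero.2 hspeed, Fin.val_inj] using hmul
  · rw [if_neg hrow] at h h'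
    exact value_injective (huv.resolve_left hrow) (h.2.trans h'.2.symm)

theorem snd_param_unique {u v : V} {s t t' : Fin N} (hrow : S.row u ≠ S.row v)
    (hv : S.speed v ≠ 0) (h : ((u, v), s, t) ∈ S.collisions) (h' : ((u, v), s, t') ∈ S.collisions) :
    t = t' := by
  rw [mem_collisions, if_neg hrow] at h h'
  exact value_injective hv (h.2.symm.trans h'.2)

theorem card_collisions_filter_fst_eq_le (p : V × V) : #{j ∈ S.collisions | j.1 = p} ≤ N := by
  obtain ⟨u, v⟩ := p
  by_cases huv : S.row u = S.row v ∨ S.speed u ≠ 0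
  · refine (card_le_card_of_injOn (t := univ) (fun j => j.2.2) (by simp) ?_).trans_eq (card_fin N)
    rintro ⟨p, s, t⟩ hj ⟨p', s', t'⟩ hj' (rfl : t = t')
    obtain ⟨hj, rfl⟩ := mem_filter.1 hj
    obtain ⟨hj', rfl⟩ := mem_filter.1 hj'
    rw [fst_param_unique huv hj hj']
  · push Not at huv
    refine (card_le_card_of_injOn (t := univ) (fun j => j.2.1) (by simp) ?_).trans_eq (card_fin N)
    rintro ⟨p, s, t⟩ hj ⟨p', s', t'⟩ hj' (rfl : s = s')
    obtain ⟨hj, rfl⟩ := mem_filter.1 hj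
    obtain ⟨hj', rfl⟩ := mem_filter.1 hj'
    have hv : S.speed v ≠ 0 := fun h => huv.1 (S.row_eq_of_speed_eq_zero huv.2 h)
    rw [snd_param_unique huv.1 hv hj hj']

theorem card_collisions_filter_le {C : (V × V) × (Fin N × Fin N) → Prop} [DecidablePred C]
    {Q : Finset (V × V)} (hQ : ∀ j ∈ S.collisions, C j → j.1 ∈ Q) :
    #{j ∈ S.collisions | C j} ≤ N * #Q := by
  refine card_le_mul_card_image_of_maps_to (f := Prod.fst)
    (fun j hj => hQ j (mem_filter.1 hj).1 (mem_filter.1 hj).2) N fun p _ => ?_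
  exact (card_le_card (filter_subset_filter _ (filter_subset _ _))).trans
    (card_collisions_filter_fst_eq_le p)

variable {q c : ℕ}

theorem card_collisions_filter_inRow_le {ν : Equiv.Perm (Fin N)} (hν : ∀ i, ν i ≠ i)
    (hq : ∀ i, #{v | S.row v = i} ≤ q) (hc : ∀ u, #{p ∈ S.pairs | p.1 = u} ≤ c) (i : Fin N) :
    #{j ∈ S.collisions | (S.cells hν j).InRow i} ≤ N * (3 * q * c) := by
  have hfst : ∀ i, #{p ∈ S.pairs | p.1 ∈ ({v | S.row v = i} : Finset V)} ≤ q * c := fun i =>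
    (card_congruentPairs_filter_fst_mem_le hc _).trans (Nat.mul_le_mul_right c (hq i))
  have hsnd : #{p ∈ S.pairs | p.2 ∈ ({v | S.row v = i} : Finset V)} ≤ q * c :=
    (card_congruentPairs_filter_snd_mem_le hc _).trans (Nat.mul_le_mul_right c (hq i))
  refine (card_collisions_filter_le (Q := ({p ∈ S.pairs | p.1 ∈ ({v | S.row v = i} : Finset V)} ∪
    {p ∈ S.pairs | p.1 ∈ ({v | S.row v = ν.symm i} : Finset V)}) ∪
    {p ∈ S.pairs | p.2 ∈ ({v | S.row v = i} : Finset V)}) fun j hj hji => ?_).trans ?_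
  · simp only [mem_union, mem_filter, mem_univ, true_and, fst_mem_pairs_of_mem_collisions hj,
      Equiv.eq_symm_apply]
    simp only [CellPair.InRow, cells] at hji
    split_ifs at hji <;> tauto
  · refine Nat.mul_le_mul_left N ?_
    calc _ ≤ q * c + q * c + q * c :=
          (card_union_le _ _).trans (add_le_add ((card_union_le _ _).trans
            (add_le_add (hfst i) (hfst _))) hsnd)
      _ = 3 * q * c := by ring

variable (S) in
/-- The pairs of vertices for which one parameter of a collision may fail to determine the other. -/
abbrev Degenerate (p : V × V) : Prop :=
  S.row p.1 = S.row p.2 ∨ S.speed p.1 = 0 ∨ S.speed p.2 = 0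

theorem card_filter_inCol_of_not_degenerate_le {ν : Equiv.Perm (Fin N)} (hν : ∀ i, ν i ≠ i)
    (t : Fin N) :
    #{j ∈ S.collisions | (S.cells hν j).InCol t ∧ ¬S.Degenerate j.1} ≤ 2 * #S.pairs := by
  refine card_le_mul_card_image_of_maps_to (f := Prod.fst)
    (fun j hj => fst_mem_pairs_of_mem_collisions (mem_filter.1 hj).1) 2 fun p _ => ?_
  by_cases hp : S.Degenerate p
  · rw [filter_filter, filter_false_of_mem (by rintro j - ⟨⟨-, h⟩, rfl⟩; exact h hp)]
    exact Nat.zero_le 2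
  simp only [Degenerate, not_or] at hp
  calc _ ≤ #({j ∈ S.collisions | j.1 = p ∧ j.2.1 = t} ∪ {j ∈ S.collisions | j.1 = p ∧ j.2.2 = t}) :=
        card_le_card fun j hj => by
          obtain ⟨hj, hjp⟩ := mem_filter.1 hj
          obtain ⟨hj, hjt, -⟩ := mem_filter.1 hj
          rw [← filter_or]
          exact mem_filter.2 ⟨hj, hjt.imp (⟨hjp, ·⟩) (⟨hjp, ·⟩)⟩
    _ ≤ 1 + 1 := (card_union_le _ _).trans (add_le_add (card_le_one.2 ?_) (card_le_one.2 ?_))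
  all_goals
    rintro ⟨p₁, s, r⟩ hj ⟨p₂, s', r'⟩ hj'
    obtain ⟨hmem, hp₁ : p₁ = p, hs⟩ := mem_filter.1 hj
    obtain ⟨hmem', hp₂ : p₂ = p, hs'⟩ := mem_filter.1 hj'
    subst hp₁ hp₂
  · obtain rfl : s = s' := hs.trans hs'.symm
    rw [snd_param_unique hp.1 hp.2.2 hmem hmem']
  · obtain rfl : r = r' := hs.trans hs'.symm
    rw [fst_param_unique (.inr hp.2.1) hmem hmem']

theorem card_filter_degenerate_le (hq : ∀ i, #{v | S.row v = i} ≤ q)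
    (hc : ∀ u, #{p ∈ S.pairs | p.1 = u} ≤ c) :
    #{p ∈ S.pairs | S.Degenerate p} ≤ 2 * q * c + #{p ∈ S.pairs | S.row p.1 = S.row p.2} := by
  have hzero : #({v | S.speed v = 0} : Finset V) * c ≤ q * c :=
    Nat.mul_le_mul_right c (card_speed_eq_zero_le hq)
  have hfst := (card_congruentPairs_filter_fst_mem_le hc {v | S.speed v = 0}).trans hzero
  have hsnd := (card_congruentPairs_filter_snd_mem_le hc {v | S.speed v = 0}).trans hzero
  simp only [mem_filter, mem_univ, true_and] at hfst hsnd
  rw [filter_or, filter_or]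
  calc _ ≤ #{p ∈ S.pairs | S.row p.1 = S.row p.2} + (q * c + q * c) :=
        (card_union_le _ _).trans (Nat.add_le_add_left
          ((card_union_le _ _).trans (add_le_add hfst hsnd)) _)
    _ = _ := by ring

theorem card_collisions_filter_inCol_le {ν : Equiv.Perm (Fin N)} (hν : ∀ i, ν i ≠ i)
    (hq : ∀ i, #{v | S.row v = i} ≤ q) (hc : ∀ u, #{p ∈ S.pairs | p.1 = u} ≤ c) (t : Fin N) :
    #{j ∈ S.collisions | (S.cells hν j).InCol t} ≤
      2 * #S.pairs + N * (2 * q * c + #{p ∈ S.pairs | S.row p.1 = S.row p.2}) := by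
  have hdeg : #{j ∈ S.collisions | (S.cells hν j).InCol t ∧ S.Degenerate j.1} ≤
      N * #{p ∈ S.pairs | S.Degenerate p} :=
    card_collisions_filter_le fun j hj h =>
      mem_filter.2 ⟨fst_mem_pairs_of_mem_collisions hj, h.2⟩
  rw [← card_filter_add_card_filter_not (fun j => ¬S.Degenerate j.1)]
  simp only [filter_filter, not_not]
  exact add_le_add (card_filter_inCol_of_not_degenerate_le hν t)
    (hdeg.trans (Nat.mul_le_mul_left N (card_filter_degenerate_le hq hc)))

theorem exists_perm_injective (hN : 2 < N) (hq : ∀ i, #{v | S.row v = i} ≤ q)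
    (hc : ∀ u, #{p ∈ S.pairs | p.1 = u} ≤ c)
    (hcount : 16 * (N * (3 * q * c) +
      (2 * #S.pairs + N * (2 * q * c + #{p ∈ S.pairs | S.row p.1 = S.row p.2}))) ≤ N * (N - 1)) :
    ∃ π : Equiv.Perm (Fin N), Function.Injective fun v => S.value v (π (S.row v)) := by
  obtain ⟨n, rfl⟩ : ∃ n, N = n + 2 := ⟨N - 2, by lia⟩
  have hν : ∀ i, Equiv.addRight (1 : Fin (n + 2)) i ≠ i := fun i => by simp
  obtain ⟨π, hπ⟩ := CellPair.exists_perm_forall_not_hits (b := S.cells hν) (E := S.collisions)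
    (by simpa using hN)
    (fun i => (card_collisions_filter_inRow_le hν hq hc i).trans (Nat.le_add_right _ _))
    (fun t => (card_collisions_filter_inCol_le hν hq hc t).trans (Nat.le_add_left _ _))
    (by simpa using hcount)
  refine ⟨π, fun u v huv => by_contra fun hne => ?_⟩
  have huv : S.value u (π (S.row u)) = S.value v (π (S.row v)) := huv
  refine hπ ((u, v), π (S.row u),
    if S.row u = S.row v then π (Equiv.addRight 1 (S.row u)) else π (S.row v)) ?_ ?_
  · rw [mem_collisions]
    split_ifs with hrow <;> simp_all
  · refine ⟨rfl, ?_⟩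
    simp only [cells]
    split_ifs <;> rfl

end MovingSums

end Separation

section FewCoincidences

theorem mul_sum_card_filter_le {β Ω : Type*} [Fintype Ω] {P : Finset β} {ev : β → Ω → Prop}
    [∀ p, DecidablePred (ev p)] {a M : ℕ} (h : ∀ p ∈ P, a * #{τ | ev p τ} ≤ M) :
    a * ∑ τ, #{p ∈ P | ev p τ} ≤ #P * M := by
  calc a * ∑ τ, #{p ∈ P | ev p τ} = ∑ p ∈ P, a * #{τ | ev p τ} := by
        rw [← mul_sum]
        exact congrArg (a * ·) (sum_card_bipartiteAbove_eq_sum_card_bipartiteBelow ev).symm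
    _ ≤ #P * M := sum_le_card_nsmul P _ M h

variable {V α : Type*} [Fintype α]

/-- The sums at the vertices with initial values `κ` and incidence matrix `I`, when the labels `g`
are arranged by `τ`. -/
def arrangedSum (κ : V → ℤ) (I : V → α → ℤ) (g : α → ℤ) (τ : Equiv.Perm α) (v : V) : ℤ :=
  κ v + ∑ e, I v e * g (τ e)

theorem arrangedSum_sub_arrangedSum (κ : V → ℤ) (I : V → α → ℤ) (g : α → ℤ) (τ : Equiv.Perm α)
    (u v : V) : arrangedSum κ I g τ u - arrangedSum κ I g τ v =
      κ u - κ v + ∑ e, (I u e - I v e) * g (τ e) := by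
  simp only [arrangedSum, sub_mul, sum_sub_distrib]
  ring

variable {κ : V → ℤ} {I : V → α → ℤ} {g : α → ℤ} {m k : ℕ}

theorem mul_card_arrangedSum_modEq_le [DecidableEq α] (hg : Function.Injective g)
    (hgm : ∀ b, g b ∈ Set.Icc 1 (m : ℤ)) (hk : 0 < k) (hkm : k ≤ m) {u v : V}
    (ha : ∃ a, I u a - I v a = 1) (hfree : m ≤ 2 * #{b | I u b - I v b = 0}) :
    k * #{τ | arrangedSum κ I g τ u ≡ arrangedSum κ I g τ v [ZMOD k]} ≤
      4 * Fintype.card (Equiv.Perm α) := by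
  obtain ⟨a, ha⟩ := ha
  have hmodEq : ∀ τ, arrangedSum κ I g τ u ≡ arrangedSum κ I g τ v [ZMOD k] ↔
      ∑ e, (I u e - I v e) * g (τ e) ≡ κ v - κ u [ZMOD k] := fun τ => by
    rw [Int.modEq_iff_dvd, Int.modEq_iff_dvd, ← neg_sub, arrangedSum_sub_arrangedSum, neg_add',
      neg_sub]
  have hM : ∀ c, #{b | c + (I u a - I v a) * g b ≡ κ v - κ u [ZMOD k]} ≤ (m + k) / k := fun c => by
    have hshift : ∀ b, c + (I u a - I v a) * g b ≡ κ v - κ u [ZMOD k] ↔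
        g b ≡ κ v - κ u - c [ZMOD k] := fun b => by
      rw [ha, one_mul, Int.modEq_iff_dvd, Int.modEq_iff_dvd, sub_sub _ c]
    simp only [hshift]
    rw [Nat.le_div_iff_mul_le hk, mul_comm]
    exact mul_card_filter_modEq_le hg hk hgm _
  have hperm := card_perm_filter_sum_mul_le (fun e => I u e - I v e) g
    (· ≡ κ v - κ u [ZMOD k]) a hM
  simp only [← hmodEq] at hperm
  set X := #{τ | arrangedSum κ I g τ u ≡ arrangedSum κ I g τ v [ZMOD k]}
  set L := #{b | I u b - I v b = 0}
  refine Nat.le_of_mul_le_mul_right (c := L) ?_ (by lia)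
  calc k * X * L = k * (X * L) := by ring
    _ ≤ k * (Fintype.card (Equiv.Perm α) * ((m + k) / k)) := Nat.mul_le_mul_left k hperm
    _ = Fintype.card (Equiv.Perm α) * (k * ((m + k) / k)) := by ring
    _ ≤ Fintype.card (Equiv.Perm α) * (4 * L) :=
      Nat.mul_le_mul_left _ ((Nat.mul_div_le (m + k) k).trans (by omega))
    _ = 4 * Fintype.card (Equiv.Perm α) * L := by ring

theorem mul_card_arrangedSum_eq_le [DecidableEq α] (hg : Function.Injective g) {u v : V}
    (ha : ∃ a, I u a - I v a = 1) (hfree : m ≤ 2 * #{b | I u b - I v b = 0}) :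
    m * #{τ | arrangedSum κ I g τ u = arrangedSum κ I g τ v} ≤
      2 * Fintype.card (Equiv.Perm α) := by
  obtain ⟨a, ha⟩ := ha
  have heq : ∀ τ, arrangedSum κ I g τ u = arrangedSum κ I g τ v ↔
      ∑ e, (I u e - I v e) * g (τ e) = κ v - κ u := fun τ => by
    rw [← sub_eq_zero, arrangedSum_sub_arrangedSum]
    constructor <;> intro h <;> linarith
  have hperm := card_perm_filter_sum_mul_le (fun e => I u e - I v e) g (· = κ v - κ u) a (M := 1)
    fun c => card_le_one.2 fun b hb b' hb' => hg <| by
      simp only [ha, one_mul, mem_filter, mem_univ, true_and] at hb hb'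
      linarith
  simp only [← heq] at hperm
  set X := #{τ | arrangedSum κ I g τ u = arrangedSum κ I g τ v}
  set L := #{b | I u b - I v b = 0}
  calc m * X ≤ 2 * L * X := Nat.mul_le_mul_right X hfree
    _ = 2 * (X * L) := by ring
    _ ≤ 2 * Fintype.card (Equiv.Perm α) := by lia

variable [Fintype V]

theorem card_offDiag_filter_eq_le {R : Type*} [DecidableEq R] {ρ : V → R} {q : ℕ}
    (hq : ∀ i, #{v | ρ v = i} ≤ q) :
    #{p ∈ (univ : Finset V).offDiag | ρ p.1 = ρ p.2} ≤ Fintype.card V * q := by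
  calc #{p ∈ (univ : Finset V).offDiag | ρ p.1 = ρ p.2} ≤ #{p : V × V | ρ p.1 = ρ p.2} :=
        card_le_card (filter_subset_filter _ (subset_univ _))
    _ = ∑ u, #{v | ρ v = ρ u} := by
        simp only [card_filter, Fintype.sum_prod_type]
        exact sum_comm
    _ ≤ Fintype.card V * q := sum_le_card_nsmul univ _ q fun u _ => hq (ρ u)

/- One arrangement meets all three bounds because they hold on average: the counts enter a single
weighted sum, with weights making the three contributions comparable. -/
theorem exists_perm_few_coincidences [Nonempty V] {R : Type*} [DecidableEq R] {ρ : V → R} {q : ℕ}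
    (hq : ∀ i, #{v | ρ v = i} ≤ q) (hg : Function.Injective g)
    (hgm : ∀ b, g b ∈ Set.Icc 1 (m : ℤ)) (hk : 0 < k) (hkm : k ≤ m)
    (hI : ∀ u v, u ≠ v → ∃ a, I u a - I v a = 1)
    (hfree : ∀ u v, m ≤ 2 * #{b | I u b - I v b = 0}) (hm : 10 * q * Fintype.card V < m)
    (κ : V → ℤ) :
    ∃ τ, k * #(congruentPairs k (arrangedSum κ I g τ)) ≤ 10 * Fintype.card V ^ 2 ∧
      k * #{p ∈ congruentPairs k (arrangedSum κ I g τ) | ρ p.1 = ρ p.2} ≤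
        10 * q * Fintype.card V ∧
      ∀ u v, u ≠ v → ρ u = ρ v → arrangedSum κ I g τ u ≠ arrangedSum κ I g τ v := by
  classical
  set W := arrangedSum κ I g
  set n := Fintype.card V
  set F := Fintype.card (Equiv.Perm α)
  set mates : Finset (V × V) := {p ∈ univ.offDiag | ρ p.1 = ρ p.2}
  have hmates : #mates ≤ n * q := card_offDiag_filter_eq_le hq
  have hqpos : 0 < q :=
    (card_pos.2 ⟨Classical.arbitrary V, by simp⟩).trans_le (hq (ρ (Classical.arbitrary V)))
  have hcong : k * ∑ τ, #(congruentPairs k (W τ)) ≤ n ^ 2 * (4 * F) :=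
    (mul_sum_card_filter_le fun p hp => mul_card_arrangedSum_modEq_le hg hgm hk hkm
      (hI _ _ (mem_offDiag.1 hp).2.2) (hfree _ _)).trans
        (Nat.mul_le_mul_right _ (by simp [offDiag_card, sq, n]))
  have hcongMates : k * ∑ τ, #{p ∈ mates | W τ p.1 ≡ W τ p.2 [ZMOD k]} ≤ n * q * (4 * F) :=
    (mul_sum_card_filter_le fun p hp => mul_card_arrangedSum_modEq_le hg hgm hk hkm
      (hI _ _ (mem_offDiag.1 (mem_filter.1 hp).1).2.2) (hfree _ _)).trans
        (Nat.mul_le_mul_right _ hmates)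
  have heqMates : m * ∑ τ, #{p ∈ mates | W τ p.1 = W τ p.2} ≤ n * q * (2 * F) :=
    (mul_sum_card_filter_le fun p hp => mul_card_arrangedSum_eq_le hg
      (hI _ _ (mem_offDiag.1 (mem_filter.1 hp).1).2.2) (hfree _ _)).trans
        (Nat.mul_le_mul_right _ hmates)
  obtain ⟨τ, -, hτ⟩ := exists_le_of_sum_le (s := (univ : Finset (Equiv.Perm α)))
    (f := fun τ => q * (k * #(congruentPairs k (W τ))) +
      n * (k * #{p ∈ mates | W τ p.1 ≡ W τ p.2 [ZMOD k]} +
        m * #{p ∈ mates | W τ p.1 = W τ p.2}))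
    (g := fun _ => 10 * q * n ^ 2) univ_nonempty <| by
      simp only [sum_add_distrib, ← mul_sum, sum_const, card_univ, smul_eq_mul]
      nlinarith only [Nat.mul_le_mul_left q hcong, Nat.mul_le_mul_left n hcongMates,
        Nat.mul_le_mul_left n heqMates]
  have hnpos : 0 < n := Fintype.card_pos
  have hsum : k * #{p ∈ mates | W τ p.1 ≡ W τ p.2 [ZMOD k]} +
      m * #{p ∈ mates | W τ p.1 = W τ p.2} ≤ 10 * q * n :=
    Nat.le_of_mul_le_mul_left ((Nat.le_add_left _ _).trans (hτ.trans_eq (by ring))) hnpos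
  refine ⟨τ, Nat.le_of_mul_le_mul_left ((Nat.le_add_right _ _).trans (hτ.trans_eq (by ring))) hqpos,
    ?_, fun u v huv hρ hW => ?_⟩
  · rw [congruentPairs, filter_comm]
    exact (Nat.le_add_right _ _).trans hsum
  · have hpos : 0 < #{p ∈ mates | W τ p.1 = W τ p.2} :=
      card_pos.2 ⟨(u, v), by simp [mates, huv, hρ, hW]⟩
    have := Nat.le_mul_of_pos_right m hpos
    lia

theorem sq_card_congruentPairs_filter_fst_le [DecidableEq V] (k : ℤ) (W : V → ℤ) (u : V) :
    #{p ∈ congruentPairs k W | p.1 = u} ^ 2 ≤ #(congruentPairs k W) := by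
  set S : Finset V := {v | W v ≡ W u [ZMOD k]}
  have hle : #{p ∈ congruentPairs k W | p.1 = u} ≤ #S - 1 := by
    rw [← card_erase_of_mem (show u ∈ S by simp [S, Int.ModEq.refl])]
    refine card_le_card_of_injOn Prod.snd ?_ ?_
    · rintro ⟨a, b⟩ hp
      obtain ⟨hmem, rfl⟩ := mem_filter.1 hp
      obtain ⟨hne, hW⟩ := mem_congruentPairs.1 hmem
      exact mem_erase.2 ⟨hne.symm, by simpa [S] using hW.symm⟩
    · rintro ⟨a, b⟩ hp ⟨a', b'⟩ hp' hbb'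
      exact Prod.ext ((mem_filter.1 hp).2.trans (mem_filter.1 hp').2.symm) hbb'
  have hsub : S.offDiag ⊆ congruentPairs k W := fun p hp => by
    simp only [mem_offDiag, S, mem_filter, mem_univ, true_and] at hp
    exact mem_congruentPairs.2 ⟨hp.2.2, hp.1.trans hp.2.1.symm⟩
  calc #{p ∈ congruentPairs k W | p.1 = u} ^ 2 ≤ (#S - 1) ^ 2 := Nat.pow_le_pow_left hle 2
    _ ≤ #S * #S - #S := by rw [sq, ← Nat.mul_sub_one]; exact Nat.mul_le_mul_right _ (Nat.sub_le _ _)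
    _ ≤ #(congruentPairs k W) := by rw [← offDiag_card]; exact card_le_card hsub

end FewCoincidences

section Labels

variable {N k : ℕ}

/-- The first `4 * N` multiples of `k`, arranged in `N` columns of four labels. A row that moves to
the next column changes its labels by `k` in the directions `rowSign`. -/
def columnLabel (N k : ℕ) (t : Fin N) (j : Fin 4) : ℕ :=
  k * ![(t : ℕ) + 1, N + t + 1, 3 * N - t, 4 * N - t] j

/-- The labels of the first column, in units of `k`. -/
def columnOffset (N : ℕ) : Fin 4 → ℤ :=
  ![1, N + 1, 3 * N, 4 * N]

theorem columnLabel_eq (t : Fin N) (j : Fin 4) :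
    (columnLabel N k t j : ℤ) = k * (columnOffset N j + rowSign j * t) := by
  rw [columnLabel, Nat.cast_mul]
  congr 1
  have := t.isLt
  fin_cases j <;> simp [columnOffset, rowSign] <;> lia

theorem columnLabel_mem_Icc (hk : 0 < k) (t : Fin N) (j : Fin 4) :
    columnLabel N k t j ∈ Icc 1 (k * (4 * N)) := by
  have hentry : ![(t : ℕ) + 1, N + t + 1, 3 * N - t, 4 * N - t] j ∈ Icc 1 (4 * N) := by
    have := t.isLt
    fin_cases j <;> simp <;> lia
  rw [mem_Icc] at hentry ⊢
  exact ⟨Nat.mul_pos hk hentry.1, Nat.mul_le_mul_left k hentry.2⟩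

theorem columnLabel_injective (hk : 0 < k) :
    Function.Injective fun p : Fin N × Fin 4 => columnLabel N k p.1 p.2 := by
  rintro ⟨t, j⟩ ⟨t', j'⟩ h
  have hentry := Nat.eq_of_mul_eq_mul_left hk h
  have := t.isLt
  have := t'.isLt
  rw [Prod.mk.injEq, Fin.ext_iff]
  fin_cases j <;> fin_cases j' <;> simp at hentry ⊢ <;> lia

variable {V : Type*} [Fintype V] [DecidableEq V] (G : SimpleGraph V) [DecidableRel G.Adj]

theorem exists_bijOn_vertexSum_eq {β : Type*} [Fintype β] {φ : β → Sym2 V}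
    (hφ : Function.Injective φ) (hrange : Set.range φ = G.edgeSet) {l : β → ℕ}
    (hl : Function.Injective l) (hlm : ∀ b, l b ∈ Icc 1 #G.edgeFinset) :
    ∃ f : Sym2 V → ℕ, Set.BijOn f G.edgeSet (Set.Icc 1 #G.edgeFinset) ∧
      ∀ v, (G.vertexSum f v : ℤ) = ∑ b, incidence v (φ b) * l b := by
  set f := Function.extend φ l 0
  have hf : ∀ b, f (φ b) = l b := hφ.extend_apply l 0
  have hE : G.edgeFinset = univ.image φ := by
    ext e
    rw [SimpleGraph.mem_edgeFinset, ← hrange]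
    simp
  have hmaps : Set.MapsTo f G.edgeFinset (Icc 1 #G.edgeFinset : Finset ℕ) := by
    rw [SimpleGraph.coe_edgeFinset, ← hrange]
    rintro _ ⟨b, rfl⟩
    simpa only [hf, coe_Icc, Set.mem_Icc, mem_Icc] using hlm b
  have hinj : Set.InjOn f G.edgeFinset := by
    rw [SimpleGraph.coe_edgeFinset, ← hrange]
    rintro _ ⟨b, rfl⟩ _ ⟨b', rfl⟩ h
    rw [hl ((hf b).symm.trans (h.trans (hf b')))]
  refine ⟨f, ?_, fun v => ?_⟩
  · rw [← SimpleGraph.coe_edgeFinset, ← coe_Icc]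
    exact ⟨hmaps, hinj, surjOn_of_injOn_of_card_le f hmaps hinj (by simp)⟩
  · have hfilter : G.incidenceFinset v = {e ∈ G.edgeFinset | v ∈ e} := by
      ext e
      simp [SimpleGraph.incidenceSet]
    rw [SimpleGraph.vertexSum, hfilter, sum_filter, hE, sum_image hφ.injOn]
    simp [incidence, hf]

end Labels

section Assembly

theorem sixteen_mul_collision_count_le {n N A B c : ℕ} (hN : 2 < N) (hn : n ≤ 28 * N)
    (hA : 10 ^ 12 * A ≤ 10 * n ^ 2) (hB : 10 ^ 12 * B ≤ 10 * 28 * n) (hc : 10 ^ 6 * c ≤ 4 * n) :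
    16 * (N * (3 * 28 * c) + (2 * A + N * (2 * 28 * c + B))) ≤ N * (N - 1) := by
  have hn2 : n ^ 2 ≤ (28 * N) ^ 2 := Nat.pow_le_pow_left hn 2
  have hB' : N * (10 ^ 8 * B) ≤ N * N := Nat.mul_le_mul_left N (by lia)
  have hc' : N * (8000 * c) ≤ N * N := Nat.mul_le_mul_left N (by lia)
  have hN' : 3 * N ≤ N * N := Nat.mul_le_mul_right N hN
  rw [Nat.mul_sub_one]
  lia

namespace RowSystem

variable {V : Type*} [Fintype V] [DecidableEq V] {G : SimpleGraph V} {N k : ℕ}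

/-- The edges of the graph outside all rows. -/
abbrev FreeEdge (S : RowSystem G N) : Type _ :=
  {e : Sym2 V // e ∈ G.edgeSet ∧ ∀ i j, (S.row i).edge j ≠ e}

/-- The edges of the graph, indexed by the positions in the rows and by the free edges. -/
def edgeOf (S : RowSystem G N) : Fin N × Fin 4 ⊕ S.FreeEdge → Sym2 V :=
  Sum.elim (fun p => (S.row p.1).edge p.2) Subtype.val

theorem edgeOf_injective (S : RowSystem G N) : Function.Injective S.edgeOf :=
  S.edge_injective.sumElim Subtype.val_injective fun p a => a.2.2 p.1 p.2

theorem range_edgeOf (S : RowSystem G N) : Set.range S.edgeOf = G.edgeSet := by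
  ext e
  rw [edgeOf, Set.Sum.elim_range]
  constructor
  · rintro (⟨p, rfl⟩ | ⟨a, rfl⟩)
    exacts [S.edge_mem _ _, a.2.1]
  · intro he
    by_cases hrow : ∃ p : Fin N × Fin 4, (S.row p.1).edge p.2 = e
    · exact Or.inl hrow
    · exact Or.inr ⟨⟨e, he, fun i j hij => hrow ⟨(i, j), hij⟩⟩, rfl⟩

/-- The part of the vertex sum at `v` contributed by the rows when all of them use the labels
`k * columnOffset N j`. -/
def startSum (S : RowSystem G N) (k : ℕ) (v : V) : ℤ :=
  k * ∑ i, ∑ j, incidence v ((S.row i).edge j) * columnOffset N j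

theorem sum_incidence_mul_columnLabel (S : RowSystem G N) (π : Equiv.Perm (Fin N)) (v : V) :
    ∑ i, ∑ j, incidence v ((S.row i).edge j) * columnLabel N k (π i) j =
      S.startSum k v + k * (S.row (S.rowOf v)).effect v * π (S.rowOf v) := by
  have hown : ∑ i, (S.row i).effect v * (π i : ℤ) =
      (S.row (S.rowOf v)).effect v * π (S.rowOf v) :=
    Fintype.sum_eq_single _ fun i hi => by rw [S.effect_eq_zero v i hi, zero_mul]
  rw [startSum, mul_assoc, ← hown, ← mul_add, ← sum_add_distrib, mul_sum]
  refine sum_congr rfl fun i _ => ?_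
  rw [Row.effect, sum_mul, ← sum_add_distrib, mul_sum]
  refine sum_congr rfl fun j _ => ?_
  rw [columnLabel_eq]
  ring

variable [DecidableRel G.Adj]

theorem card_freeEdge_add (S : RowSystem G N) :
    Fintype.card S.FreeEdge + 4 * N = #G.edgeFinset := by
  rw [SimpleGraph.edgeFinset_card, ← Fintype.card_congr
    ((Equiv.ofInjective _ S.edgeOf_injective).trans (Equiv.setCongr S.range_edgeOf))]
  simp only [Fintype.card_sum, Fintype.card_prod, Fintype.card_fin]
  ring

theorem exists_freeLabel (S : RowSystem G N) (hk : 0 < k) (hkm : k * (4 * N) ≤ #G.edgeFinset) :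
    ∃ g : S.FreeEdge → ℕ, Function.Injective g ∧
      ∀ a, g a ∈ Icc 1 #G.edgeFinset ∧ ∀ t j, columnLabel N k t j ≠ g a := by
  set L : Finset ℕ := univ.image fun p : Fin N × Fin 4 => columnLabel N k p.1 p.2
  have hL : L ⊆ Icc 1 #G.edgeFinset := by
    simp only [L, image_subset_iff]
    exact fun p _ => Icc_subset_Icc_right hkm (columnLabel_mem_Icc hk p.1 p.2)
  have hcard : Fintype.card S.FreeEdge = Fintype.card (Icc 1 #G.edgeFinset \ L : Finset ℕ) := by
    rw [Fintype.card_coe, card_sdiff_of_subset hL, card_image_of_injective _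
      (columnLabel_injective hk), ← S.card_freeEdge_add]
    simp [mul_comm]
  let g := Fintype.equivOfCardEq hcard
  refine ⟨fun a => g a, Subtype.val_injective.comp g.injective, fun a => ?_⟩
  obtain ⟨hmem, hnot⟩ := mem_sdiff.1 (g a).2
  exact ⟨hmem, fun t j h => hnot (mem_image.2 ⟨(t, j), mem_univ _, h⟩)⟩

theorem isAntimagic_of_injective (S : RowSystem G N) (hk : 0 < k)
    (hkm : k * (4 * N) ≤ #G.edgeFinset) {g : S.FreeEdge → ℕ} (hg : Function.Injective g)
    (hgm : ∀ a, g a ∈ Icc 1 #G.edgeFinset ∧ ∀ t j, columnLabel N k t j ≠ g a)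
    {π : Equiv.Perm (Fin N)}
    (hinj : Function.Injective fun v => S.startSum k v + ∑ a, incidence v a.1 * (g a : ℤ) +
      k * (S.row (S.rowOf v)).effect v * π (S.rowOf v)) : G.IsAntimagic := by
  have hcol : Function.Injective fun p : Fin N × Fin 4 => columnLabel N k (π p.1) p.2 :=
    (columnLabel_injective hk).comp (π.injective.prodMap Function.injective_id)
  obtain ⟨f, hf, hsum⟩ := exists_bijOn_vertexSum_eq G S.edgeOf_injective S.range_edgeOf
    (hcol.sumElim hg fun p a => (hgm a).2 _ _) <| Sum.rec
      (fun p => Icc_subset_Icc_right hkm (columnLabel_mem_Icc hk _ _)) fun a => (hgm a).1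
  have hvalue : ∀ v, (G.vertexSum f v : ℤ) =
      S.startSum k v + ∑ a, incidence v a.1 * (g a : ℤ) +
        k * (S.row (S.rowOf v)).effect v * π (S.rowOf v) := fun v => by
    rw [hsum v, Fintype.sum_sum_type, Fintype.sum_prod_type, add_right_comm,
      ← S.sum_incidence_mul_columnLabel]
    rfl
  refine ⟨f, hf, fun u v huv => hinj ?_⟩
  simp only [← hvalue, huv]

theorem card_edgeFinset_le_two_mul_card_unaffected (S : RowSystem G N)
    (hN : 4 * N ≤ Fintype.card V) (hm : 6 * Fintype.card V ≤ #G.edgeFinset) (u v : V) :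
    #G.edgeFinset ≤ 2 * #{a : S.FreeEdge | incidence u a.1 - incidence v a.1 = 0} := by
  have haffected : #{a : S.FreeEdge | ¬incidence u a.1 - incidence v a.1 = 0} ≤
      #(G.incidenceFinset u ∪ G.incidenceFinset v) := by
    refine card_le_card_of_injOn Subtype.val (fun a ha => ?_) Subtype.val_injective.injOn
    by_contra hnot
    simp only [mem_coe, mem_union, SimpleGraph.mem_incidenceFinset, SimpleGraph.incidenceSet,
      Set.mem_sep_iff, a.2.1, true_and, not_or] at hnot
    exact (mem_filter.1 ha).2 (by simp [incidence, hnot])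
  have hdegree := haffected.trans (card_union_le _ _)
  rw [G.card_incidenceFinset_eq_degree, G.card_incidenceFinset_eq_degree] at hdegree
  have hsplit := card_filter_add_card_filter_not (s := (univ : Finset S.FreeEdge))
    fun a => incidence u a.1 - incidence v a.1 = 0
  rw [card_univ] at hsplit
  have := S.card_freeEdge_add
  have := G.degree_lt_card_verts u
  have := G.degree_lt_card_verts v
  lia

theorem isAntimagic (S : RowSystem G N) (hN : 2 < N) (hNV : 4 * N ≤ Fintype.card V)
    (hVN : Fintype.card V ≤ 28 * N) (hm : 10 ^ 12 * Fintype.card V ≤ #G.edgeFinset) :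
    G.IsAntimagic := by
  set n := Fintype.card V
  set k : ℕ := 10 ^ 12 with hk
  have hkm : k * (4 * N) ≤ #G.edgeFinset := (Nat.mul_le_mul_left k hNV).trans hm
  have : Nonempty V := Fintype.card_pos_iff.1 (by lia)
  obtain ⟨g, hg, hgm⟩ := S.exists_freeLabel (by lia) hkm
  obtain ⟨τ, hA, hB, hne⟩ := exists_perm_few_coincidences (k := k) S.card_rowOf_eq_le
    (I := fun v (a : S.FreeEdge) => incidence v a.1) (Nat.cast_injective.comp hg)
    (fun a => by simpa [mem_Icc] using (hgm a).1) (by lia) (by lia)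
    (fun u v huv => by
      obtain ⟨e, he, hrow, hu, hv⟩ := S.exists_free u v huv
      exact ⟨⟨e, he, hrow⟩, by simp [incidence, hu, hv]⟩)
    (S.card_edgeFinset_le_two_mul_card_unaffected hNV (by lia)) (by lia) (S.startSum k)
  set W := arrangedSum (S.startSum k) (fun v (a : S.FreeEdge) => incidence v a.1)
    (Nat.cast ∘ g) τ
  let M : MovingSums V N :=
    { base := W
      row := S.rowOf
      modulus := k
      speed := fun v => (S.row (S.rowOf v)).effect v
      modulus_ne_zero := by simp [hk]
      base_ne := fun {u v} => hne u v
      row_eq_of_speed_eq_zero := fun {u v} => S.rowOf_eq u v }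
  -- A vertex in `c` coincidences lies in a residue class of `c + 1` vertices, which alone accounts
  -- for at least `c ^ 2` coincidences. Hence `k * c ^ 2 ≤ 10 * n ^ 2`.
  have hc : ∀ u, #{p ∈ M.pairs | p.1 = u} ≤ 4 * n / 10 ^ 6 := fun u => by
    rw [Nat.le_div_iff_mul_le (by norm_num), ← Nat.pow_le_pow_iff_left two_ne_zero]
    have := sq_card_congruentPairs_filter_fst_le (k : ℤ) W u
    calc _ = k * #{p ∈ M.pairs | p.1 = u} ^ 2 := by rw [hk]; ring
      _ ≤ k * #M.pairs := Nat.mul_le_mul_left k this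
      _ ≤ (4 * n) ^ 2 := hA.trans (by lia)
  obtain ⟨π, hπ⟩ := M.exists_perm_injective hN S.card_rowOf_eq_le hc
    (sixteen_mul_collision_count_le hN hVN hA hB (Nat.mul_div_le _ _))
  exact S.isAntimagic_of_injective (by lia) hkm (hg.comp τ.injective) (fun a => hgm (τ a)) hπ

end RowSystem

variable {V : Type*} [Fintype V] (G : SimpleGraph V) [DecidableRel G.Adj]

theorem minDegree_mul_card_le_two_mul_card_edgeFinset :
    G.minDegree * Fintype.card V ≤ 2 * #G.edgeFinset := by
  rw [← G.sum_degrees_eq_twice_card_edges, mul_comm]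
  exact card_nsmul_le_sum univ (fun v => G.degree v) _ fun v _ => G.minDegree_le_degree v

variable [DecidableEq V]

theorem isAntimagic_of_subsingleton [Subsingleton V] : G.IsAntimagic := by
  obtain rfl : G = ⊥ := Subsingleton.elim _ _
  exact ⟨0, by simp, Function.injective_of_subsingleton _⟩

theorem theorem1_general (hG : 2 * 10 ^ 12 ≤ G.minDegree) : G.IsAntimagic := by
  have : Nonempty V := not_isEmpty_iff.1 fun _ => by simp at hG
  have hV : G.minDegree < Fintype.card V := G.minDegree_lt_card
  obtain ⟨N, ⟨S⟩, hNV, hVN⟩ := exists_rowSystem (G := G) (by lia) (by lia)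
  have hm := minDegree_mul_card_le_two_mul_card_edgeFinset G
  have := Nat.mul_le_mul_right (Fintype.card V) hG
  exact S.isAntimagic (by lia) hNV hVN (by lia)

end Assembly

theorem theorem1 :
    ∃ C : ℝ, ∀ (V : Type*) [Fintype V] [DecidableEq V] (G : SimpleGraph V) [DecidableRel G.Adj],
      C * Real.log (Fintype.card V : ℝ) ≤ (G.minDegree : ℝ) → G.IsAntimagic := by
  refine ⟨2 * 10 ^ 12 / Real.log 2, fun V _ _ G _ hG => ?_⟩
  cases subsingleton_or_nontrivial V
  · exact isAntimagic_of_subsingleton G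
  · have hlog : Real.log 2 ≤ Real.log (Fintype.card V) :=
      Real.log_le_log two_pos (by exact_mod_cast Fintype.one_lt_card)
    have hdeg : (2 * 10 ^ 12 : ℝ) ≤ G.minDegree :=
      calc (2 * 10 ^ 12 : ℝ) = 2 * 10 ^ 12 / Real.log 2 * Real.log 2 := by field_simp
        _ ≤ 2 * 10 ^ 12 / Real.log 2 * Real.log (Fintype.card V) := by gcongr
        _ ≤ G.minDegree := hG
    exact theorem1_general G (by exact_mod_cast hdeg)
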